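/- **Setting.** Let $0<\sigma<R$ and let $\Phi$ be an interaction potential with a hard core of length $\sigma$ and range $R$: $\Phi$ is twice continuously differentiable on $\{q\in\mathbb R:|q|>\sigma\}$, $\Phi(q)=0$ for $|q|>R$, and $\Phi(q)\to+\infty$ as $|q|\to\sigma+0$. Consider ordered particles of unit mass on the line with phase coordinates $x_i=(q_i,p_i)\in\mathbb R\times\mathbb R$, numbered by $-n_1,\dots,-1,1,\dots,n_2$ (the successor $i+1$ of $i=-1$ is understood as $1$). The allowed configurations are those with $\sigma+q_i<q_{i+1}$ for all neighbours. For a set $X$ of consecutive particles let $X(t,\cdot)$ be the global Hamiltonian flow on the allowed configurations of these particles, with Hamiltonian $\sum_i p_i^2/2+\sum_{(i,i+1)}\Phi(q_i-q_{i+1})$, and let the Liouville group $S^*(t,X)$ act on functions of the variables of $X$ by $(S^*(t,X)f)(x)=f(X(-t,x))$ on allowed configurations and by $0$ on forbidden ones. Its generator is $\mathcal L^*=\sum_j\mathcal L^*(j)+\sum_{(j,j+1)}\mathcal L^*_{\rm int}(j,j+1)$ with $$\mathcal L^*(j)=-p_j\frac{\partial}{\partial q_j},\qquad \mathcal L^*_{\rm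 int}(j,j+1)=\Phi'(q_j-q_{j+1})\Big(\frac{\partial}{\partial p_j}-\frac{\partial}{\partial p_{j+1}}\Big).$$ **Hierarchy.** The nonlinear Liouville hierarchy for a double sequence $g(t)=\{g_{s_1+s_2}(t,x_{-s_1},\dots,x_{s_2})\}_{s_1+s_2\ge1}$ of functions on the allowed configurations (extended by zero to the forbidden ones) is $$\frac{\partial}{\partial t}g_{s_1+s_2}(t)=\mathcal L^*_{s_1+s_2}g_{s_1+s_2}(t)+\sum_{(x_{-s_1},\dots,x_{s_2})=X_1\cup X_2}\mathcal L^*_{\rm int}(j,j+1)\,g_{|X_1|}(t,X_1)\,g_{|X_2|}(t,X_2),\qquad g_{s_1+s_2}(0)=g^0_{s_1+s_2},$$ where the sum is over the partitions into two consecutive nonempty blocks $X_1,X_2$, and $j$ is the largest index in $X_1$. **Theorem.** Let $g^0=\{g^0_{s_1+s_2}\}_{s_1+s_2\ge 1}$ be an arbitrary double sequence of integrable functions that vanish on the forbidden configurations. For $t\in\mathbb R$ put, on the allowed configurations, $$g_{s_1+s_2}(t)=\sum_{\mathrm P:(x_{-s_1},\dots,x_{s_2})=\bigcup_iX_i}\mathfrak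 A_{|\mathrm P|}(t,\{X_1\},\dots,\{X_{|\mathrm P|}\})\prod_{X_i\subset\mathrm P}g^0_{|X_i|}(X_i),$$ $$\mathfrak A_{|\mathrm P|}(t,\{X_1\},\dots,\{X_{|\mathrm P|}\})=\sum_{\mathrm P'}(-1)^{|\mathrm P'|-1}\prod_{Z_k\subset\mathrm P'}S^*(t,\theta(Z_k)),$$ and $g_{s_1+s_2}(t)=0$ on the forbidden ones; here $\mathrm P$ runs over the partitions of the ordered particles into contiguous nonempty blocks, $\mathrm P'$ over the partitions of the ordered set of blocks $(\{X_1\},\dots,\{X_{|\mathrm P|}\})$ into contiguous nonempty parts $Z_k$, and $\theta(Z_k)$ is the set of all particles in the blocks of $Z_k$. Then: 1. $g(t)$ is, for all $t\in\mathbb R$, a weak solution of the Cauchy problem: every $g_{s_1+s_2}(t)$ is integrable, $g_{s_1+s_2}(0)=g^0_{s_1+s_2}$ almost everywhere, and for every continuously differentiable test function $\varphi$ with compact support in the open set of allowed configurations and every $t\in\mathbb R$ $$\frac{d}{dt}\int g_{s_1+s_2}(t)\,\varphi\,dx=-\int g_{s_1+s_2}(t)\,\mathcal L^*_{s_1+s_2}\varphi\,dx-\sum_{X_1\cup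 X_2}\int g_{|X_1|}(t,X_1)\,g_{|X_2|}(t,X_2)\,\mathcal L^*_{\rm int}(j,j+1)\varphi\,dx .$$ 2. If moreover all $g^0_{s_1+s_2}$ are infinitely differentiable on the allowed configurations and have compact supports, then $g(t)$ is a strong (classical) solution: every $g_{s_1+s_2}(t)$ is integrable, $g_{s_1+s_2}$ is continuously differentiable in $(t,x)$ for $t\in\mathbb R$ and $x$ in the open set of allowed configurations, the equations of the hierarchy hold there pointwise, and the initial condition holds everywhere. -/

import Mathlib

open MeasureTheory Set Filter Topology
open scoped ContDiff

/-- Phase space of `n` particles on a line: the particle in position `i` (counted from the left)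
has phase coordinates `x i = (q_i, p_i)`. -/
abbrev Phase (n : ℕ) : Type := Fin n → ℝ × ℝ

/-- Left member of the `j`-th pair of nearest neighbours. -/
def leftOf {n : ℕ} (j : Fin (n - 1)) : Fin n := ⟨j, by omega⟩

/-- Right member of the `j`-th pair of nearest neighbours. -/
def rightOf {n : ℕ} (j : Fin (n - 1)) : Fin n := ⟨j + 1, by omega⟩

/-- Interaction potentials of range `R` with a hard core of length `σ`: twice continuously
differentiable outside the core, zero beyond the range, and infinitely repulsive at the core. -/
structure IsCorePotential (Φ : ℝ → ℝ) (σ R : ℝ) : Prop where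
  contDiffOn : ContDiffOn ℝ 2 Φ {q | σ < |q|}
  eq_zero : ∀ q, R < |q| → Φ q = 0
  core : Tendsto Φ (comap (fun q : ℝ => |q|) (𝓝[>] σ)) atTop

/-- Allowed configurations: neighbouring particles are ordered and at distance more than `σ`
(at distance `σ` the potential is infinite). -/
def allowed (σ : ℝ) (n : ℕ) : Set (Phase n) :=
  {x | ∀ j : Fin (n - 1), σ + (x (leftOf j)).1 < (x (rightOf j)).1}

/-- Coordinate direction of `q_i`. -/
def dirQ {n : ℕ} (i : Fin n) : Phase n := Pi.single i (1, 0)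

/-- Coordinate direction of `p_i`. -/
def dirP {n : ℕ} (i : Fin n) : Phase n := Pi.single i (0, 1)

/-- Hamiltonian of `n` particles of unit mass with nearest-neighbour interaction. -/
noncomputable def hamiltonian (Φ : ℝ → ℝ) {n : ℕ} (x : Phase n) : ℝ :=
  ∑ i, (x i).2 ^ 2 / 2 + ∑ j : Fin (n - 1), Φ ((x (leftOf j)).1 - (x (rightOf j)).1)

/-- Hamiltonian vector field: `q_i' = ∂H/∂p_i`, `p_i' = -∂H/∂q_i`. -/
noncomputable def hamField (Φ : ℝ → ℝ) {n : ℕ} (x : Phase n) : Phase n := fun i =>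
  (fderiv ℝ (hamiltonian Φ) x (dirP i), -fderiv ℝ (hamiltonian Φ) x (dirQ i))

/-- Global-in-time solutions of the Hamilton equations within the allowed configurations. -/
def IsTrajectory (Φ : ℝ → ℝ) (σ : ℝ) {n : ℕ} (γ : ℝ → Phase n) : Prop :=
  ∀ t, γ t ∈ allowed σ n ∧ HasDerivAt γ (hamField Φ (γ t)) t

open Classical in
/-- `flow Φ σ t x` is the phase point `X(t, x)` reached at time `t` by the solution of the Hamilton
equations which starts at `x` at time `0`. -/
noncomputable def flow (Φ : ℝ → ℝ) (σ : ℝ) {n : ℕ} (t : ℝ) (x : Phase n) : Phase n :=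
  if h : ∃ γ : ℝ → Phase n, IsTrajectory Φ σ γ ∧ γ 0 = x then h.choose t else x

/-- Phase coordinates of the particles in the block `k` of the partition `c`.  Partitions of the
ordered particles into contiguous nonempty blocks are Mathlib's compositions of `n`. -/
def blockConf {n : ℕ} (c : Composition n) (k : Fin c.length) (x : Phase n) :
    Phase (c.blocksFun k) := fun l => x (c.embedding k l)

open Classical in
/-- The product `∏ₖ S*(t, X_k)` over the blocks `X_k` of the partition `c` of the Liouville groups
of these blocks. Each factor moves the variables of its own block along the Hamiltonian trajectories
of that block alone for time `-t`, and gives `0` where that block is in a forbidden configuration.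
For the partition into one block this is the Liouville group `S*(t)` of all the particles. -/
noncomputable def blockGroups (Φ : ℝ → ℝ) (σ t : ℝ) {n : ℕ} (c : Composition n)
    (F : Phase n → ℝ) (x : Phase n) : ℝ :=
  if ∀ k, blockConf c k x ∈ allowed σ (c.blocksFun k) then
    F (fun i => flow Φ σ (-t) (blockConf c (c.index i) x) (c.invEmbedding i))
  else 0

/-- The cumulant `𝔄_{|P|}(t, {X_1}, …, {X_{|P|}})` of the Liouville groups, where `P = c` has the
blocks `X_i`.  The sum is over the partitions `b` of the ordered set of these blocks, and `c.gather b`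
is the partition of the particles in which each part of `b` is declusterized. -/
noncomputable def cumulant (Φ : ℝ → ℝ) (σ t : ℝ) {n : ℕ} (c : Composition n)
    (F : Phase n → ℝ) (x : Phase n) : ℝ :=
  ∑ b : Composition c.length, (-1 : ℝ) ^ (b.length - 1) * blockGroups Φ σ t (c.gather b) F x

/-- A double sequence `f_{n₁+n₂}(x_{-n₁}, …, x_{-1}, x_1, …, x_{n₂})` of functions.  The function
`f_{n₁+n₂}` is `f (n₁ + n₂) n₁`: the first index is the number of particles and the second one is
the number of those with negative numbers.  Only the `f n m` with `1 ≤ n` and `m ≤ n` matter. -/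
abbrev DoubleSeq : Type := (n : ℕ) → ℕ → Phase n → ℝ

/-- Number of particles with negative numbers in the block `k` of the partition `c`, if the first
`m` of all the particles have negative numbers. -/
def negCount {n : ℕ} (c : Composition n) (k : Fin c.length) (m : ℕ) : ℕ :=
  (Finset.univ.filter fun l : Fin (c.blocksFun k) => (c.embedding k l : ℕ) < m).card

/-- The product `∏ g_{|X_i|}(X_i)` over the blocks `X_i` of the partition `c`. -/
def blockProd (g : DoubleSeq) {n : ℕ} (m : ℕ) (c : Composition n) (x : Phase n) : ℝ :=
  ∏ k, g (c.blocksFun k) (negCount c k m) (blockConf c k x)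

open Classical in
/-- The correlation functions
`g_{n₁+n₂}(t) = ∑_P 𝔄_{|P|}(t, {X_1}, …, {X_{|P|}}) ∏_{X_i ∈ P} g⁰_{|X_i|}(X_i)`, functions on the
allowed configurations which are extended by zero to the forbidden ones. -/
noncomputable def correlation (Φ : ℝ → ℝ) (σ : ℝ) (g0 : DoubleSeq) (t : ℝ) : DoubleSeq :=
  fun n m x => if x ∈ allowed σ n then
    ∑ c : Composition n, cumulant Φ σ t c (blockProd g0 m c) x else 0

/-- `L*(i) = -p_i ∂/∂q_i`. -/
noncomputable def freeL {n : ℕ} (i : Fin n) (f : Phase n → ℝ) (x : Phase n) : ℝ :=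
  -(x i).2 * fderiv ℝ f x (dirQ i)

/-- `L*_int(j, j+1) = Φ'(q_j - q_{j+1}) (∂/∂p_j - ∂/∂p_{j+1})`. -/
noncomputable def intL (Φ : ℝ → ℝ) {n : ℕ} (j : Fin (n - 1)) (f : Phase n → ℝ) (x : Phase n) : ℝ :=
  deriv Φ ((x (leftOf j)).1 - (x (rightOf j)).1) *
    (fderiv ℝ f x (dirP (leftOf j)) - fderiv ℝ f x (dirP (rightOf j)))

/-- The Liouville operator of `n` particles. -/
noncomputable def liouvilleL (Φ : ℝ → ℝ) {n : ℕ} (f : Phase n → ℝ) (x : Phase n) : ℝ :=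
  ∑ i, freeL i f x + ∑ j : Fin (n - 1), intL Φ j f x

/-- The product `g_{|X_1|}(X_1) g_{|X_2|}(X_2)` for the partition into two blocks where the last
particle of `X_1` is the left member of the `j`-th pair of nearest neighbours. -/
def splitProd (g : DoubleSeq) {n : ℕ} (m : ℕ) (j : Fin (n - 1)) (x : Phase n) : ℝ :=
  g (j + 1) (min m (j + 1)) (fun l => x ⟨l, by omega⟩) *
    g (n - (j + 1)) (m - (j + 1)) (fun l => x ⟨j + 1 + l, by omega⟩)

/-- Double sequences of integrable functions which vanish on the forbidden configurations. -/
def IsL1Seq (σ : ℝ) (g : DoubleSeq) : Prop :=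
  ∀ n m, 1 ≤ n → m ≤ n → Integrable (g n m) ∧ ∀ x, x ∉ allowed σ n → g n m x = 0

/-- Double sequences of infinitely differentiable functions (on the allowed configurations) with
compact supports. -/
def IsSmoothSeq (σ : ℝ) (g : DoubleSeq) : Prop :=
  ∀ n m, 1 ≤ n → m ≤ n → ContDiffOn ℝ ∞ (g n m) (allowed σ n) ∧ HasCompactSupport (g n m)

/-- Strong (classical) solutions of the Cauchy problem of the nonlinear Liouville hierarchy. -/
def IsClassicalSolution (Φ : ℝ → ℝ) (σ : ℝ) (g0 : DoubleSeq) (g : ℝ → DoubleSeq) : Prop :=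
  (∀ t, IsL1Seq σ (g t)) ∧
  ∀ n m, 1 ≤ n → m ≤ n →
    ContDiffOn ℝ 1 (fun z : ℝ × Phase n => g z.1 n m z.2) (univ ×ˢ allowed σ n) ∧
    (∀ x, g 0 n m x = g0 n m x) ∧
    ∀ t, ∀ x ∈ allowed σ n,
      HasDerivAt (fun s => g s n m x)
        (liouvilleL Φ (g t n m) x + ∑ j : Fin (n - 1), intL Φ j (splitProd (g t) m j) x) t

/-- Weak (generalized) solutions of the Cauchy problem of the nonlinear Liouville hierarchy: the
Liouville operators, which are skew-symmetric, act on the test functions. -/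
def IsWeakSolution (Φ : ℝ → ℝ) (σ : ℝ) (g0 : DoubleSeq) (g : ℝ → DoubleSeq) : Prop :=
  (∀ t, IsL1Seq σ (g t)) ∧
  ∀ n m, 1 ≤ n → m ≤ n →
    g 0 n m =ᵐ[volume] g0 n m ∧
    ∀ φ : Phase n → ℝ, ContDiff ℝ 1 φ → HasCompactSupport φ → tsupport φ ⊆ allowed σ n →
      ∀ t, HasDerivAt (fun s => ∫ x, g s n m x * φ x)
        (-(∫ x, g t n m x * liouvilleL Φ φ x) -
          ∑ j : Fin (n - 1), ∫ x, splitProd (g t) m j x * intL Φ j φ x) t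

/-! Expand `correlation` into signed terms indexed by a partition `c` and a partition `b` of its
blocks. Each term is an initial product transported by independent motions of the blocks of
`c.gather b`, that is, by the flow in which only the neighbouring pairs inside these blocks interact
(`isPairFlow_blockFlow`). Its generator is the full Liouville operator without the interactions of
the pairs cut by `c.gather b` (`liouvilleL_eq`). So the time derivative of the sum is the full
operator applied to it, minus, for each pair `j`, the interaction operator of `j` applied to the sum
of the terms that cut `j`.

That last sum equals minus the product of the two correlation functions on either side of `j`
(`sum_cumulant_notMem_innerPairs`), which gives the nonlinear term. The reason is algebraic:
grouping terms by `d = c.gather b` turns the expansion into an alternating sum over `d` of products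
of the evolved sums `evolvedSum` over the blocks of `d`. A partition cutting `j` is a pair of
partitions of the left and right particles, and the sign exponent `length - 1` is additive up to one
extra factor `-1`. The identity holds pointwise before any differentiation, so it serves both the
weak and the classical statement. At time zero only the one-block partition survives, because the
alternating sum over the compositions of `k ≥ 2` is zero.

The dynamics is singular at the core, but energy conservation keeps an orbit away from it. Below a
given energy the potential can be replaced by one with compactly supported derivative, whose field
is globally Lipschitz and divergence free (`exists_flow_below`). This yields a global `C¹`
volume-preserving flow, hence integrability, and in the weak case the transfer of the motion to the
test function. -/

/-! ### Global flows of Lipschitz vector fields and their differentiability. -/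

section LipschitzODE

open Real
open scoped NNReal

variable {E : Type*} [NormedAddCommGroup E] [NormedSpace ℝ E]

/-- Integration against the weight `exp (l * |s|)` gains a factor `1 / l`; a large `l` therefore
makes the Picard map contracting on the whole line at once. -/
theorem norm_integral_le_exp_of_nonneg {h : ℝ → E} {B l : ℝ} (hl : 0 < l) (hB : 0 ≤ B)
    (hh : ∀ s, ‖h s‖ ≤ B * exp (l * |s|)) {t : ℝ} (ht : 0 ≤ t) :
    ‖∫ s in (0 : ℝ)..t, h s‖ ≤ B / l * exp (l * |t|) := by
  have hd : ∀ s, HasDerivAt (fun s => B / l * exp (l * s)) (B * exp (l * s)) s := by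
    intro s
    have h1 : HasDerivAt (fun s => exp (l * s)) (exp (l * s) * l) s := by
      simpa using ((hasDerivAt_id s).const_mul l).exp
    have h2 := h1.const_mul (B / l)
    rwa [show B / l * (exp (l * s) * l) = B * exp (l * s) by field_simp] at h2
  have hc : Continuous fun s => B * exp (l * s) := by fun_prop
  calc ‖∫ s in (0 : ℝ)..t, h s‖ ≤ ∫ s in (0 : ℝ)..t, B * exp (l * s) := by
        refine intervalIntegral.norm_integral_le_of_norm_le ht (ae_of_all _ fun s hs => ?_)
          (hc.intervalIntegrable _ _)
        simpa [abs_of_pos hs.1] using hh s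
    _ = B / l * exp (l * t) - B / l * exp (l * 0) :=
        intervalIntegral.integral_eq_sub_of_hasDerivAt (fun s _ => hd s)
          (hc.intervalIntegrable _ _)
    _ ≤ B / l * exp (l * |t|) := by
        rw [abs_of_nonneg ht]
        have : 0 ≤ B / l * exp (l * 0) := by positivity
        linarith

theorem norm_integral_le_exp {h : ℝ → E} {B l : ℝ} (hl : 0 < l) (hB : 0 ≤ B)
    (hh : ∀ s, ‖h s‖ ≤ B * exp (l * |s|)) (t : ℝ) :
    ‖∫ s in (0 : ℝ)..t, h s‖ ≤ B / l * exp (l * |t|) := by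
  rcases le_total 0 t with ht | ht
  · exact norm_integral_le_exp_of_nonneg hl hB hh ht
  · have := norm_integral_le_exp_of_nonneg (h := fun s => h (-s)) hl hB
      (fun s => by simpa using hh (-s)) (t := -t) (by linarith)
    rw [intervalIntegral.integral_comp_neg, intervalIntegral.integral_symm] at this
    simpa using this

open BoundedContinuousFunction in
/-- Global solutions of differential equations with globally Lipschitz right-hand sides. -/
theorem exists_global_solution [CompleteSpace E] {f : ℝ → E → E} {K : ℝ≥0} {C : ℝ}
    (hf : Continuous fun z : ℝ × E => f z.1 z.2) (hK : ∀ t, LipschitzWith K (f t))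
    (hC : ∀ t, ‖f t 0‖ ≤ C) (x : E) :
    ∃ γ : ℝ → E, γ 0 = x ∧ ∀ t, HasDerivAt γ (f t (γ t)) t := by
  -- The unknown is the damped curve `u t = exp (-l|t|) • γ t`, a bounded function. In these
  -- variables the Picard map has Lipschitz constant `K / l ≤ 1 / 2`.
  set l : ℝ := 2 * (K + 1) with hl
  have hl0 : 0 < l := by positivity
  have hC0 : 0 ≤ C := (norm_nonneg _).trans (hC 0)
  have hexp : ∀ s, 1 ≤ exp (l * |s|) := fun s => one_le_exp (by positivity)
  let w (u : ℝ →ᵇ E) (s : ℝ) : E := f s (exp (l * |s|) • u s)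
  have hwc : ∀ u, Continuous (w u) := fun u => by
    have : Continuous fun s : ℝ => ((s, exp (l * |s|) • u s) : ℝ × E) := by fun_prop
    exact hf.comp this
  let I (u : ℝ →ᵇ E) (t : ℝ) : E := x + ∫ s in (0 : ℝ)..t, w u s
  have hId : ∀ u t, HasDerivAt (I u) (w u t) t := fun u t => by
    exact (intervalIntegral.integral_hasDerivAt_right ((hwc u).intervalIntegrable _ _)
      ((hwc u).stronglyMeasurableAtFilter _ _) (hwc u).continuousAt).const_add x
  have hIc : ∀ u, Continuous (I u) := fun u =>
    continuous_iff_continuousAt.2 fun t => (hId u t).continuousAt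
  have hwb : ∀ u s, ‖w u s‖ ≤ (C + K * ‖u‖) * exp (l * |s|) := fun u s => by
    have h1 : ‖w u s - f s 0‖ ≤ K * ‖exp (l * |s|) • u s - 0‖ := by
      simpa only [dist_eq_norm] using (hK s).dist_le_mul _ _
    have h2 : ‖exp (l * |s|) • u s - 0‖ ≤ exp (l * |s|) * ‖u‖ := by
      rw [sub_zero, norm_smul, norm_of_nonneg (exp_pos _).le]
      exact mul_le_mul_of_nonneg_left (u.norm_coe_le_norm s) (exp_pos _).le
    have h3 : ‖w u s‖ ≤ ‖w u s - f s 0‖ + ‖f s 0‖ := by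
      simpa using norm_add_le (w u s - f s 0) (f s 0)
    have h4 : (K : ℝ) * ‖exp (l * |s|) • u s - 0‖ ≤ K * (exp (l * |s|) * ‖u‖) :=
      mul_le_mul_of_nonneg_left h2 K.2
    have h5 : C ≤ C * exp (l * |s|) := le_mul_of_one_le_right hC0 (hexp s)
    nlinarith [hC s]
  have hcancel : ∀ (t a : ℝ), exp (-(l * |t|)) * (a * exp (l * |t|)) = a := fun t a => by
    rw [exp_neg]; field_simp
  let P (u : ℝ →ᵇ E) : ℝ →ᵇ E :=
    ofNormedAddCommGroup (fun t => exp (-(l * |t|)) • I u t)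
      (by have := hIc u; fun_prop) (‖x‖ + (C + K * ‖u‖) / l) fun t => by
        rw [norm_smul, norm_of_nonneg (exp_pos _).le]
        have h1 : ‖I u t‖ ≤ ‖x‖ + (C + K * ‖u‖) / l * exp (l * |t|) :=
          (norm_add_le _ _).trans (add_le_add le_rfl
            (norm_integral_le_exp hl0 (by positivity) (hwb u) t))
        have h2 : ‖x‖ ≤ ‖x‖ * exp (l * |t|) := le_mul_of_one_le_right (norm_nonneg _) (hexp t)
        calc exp (-(l * |t|)) * ‖I u t‖
            ≤ exp (-(l * |t|)) * ((‖x‖ + (C + K * ‖u‖) / l) * exp (l * |t|)) :=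
              mul_le_mul_of_nonneg_left (by linarith) (exp_pos _).le
          _ = _ := hcancel _ _
  have hP : ContractingWith (1 / 2) P := by
    refine ⟨by rw [← NNReal.coe_lt_coe]; norm_num, LipschitzWith.of_dist_le_mul fun u v => ?_⟩
    refine (dist_le (by positivity)).2 fun t => ?_
    have h1 : ∀ s, ‖w u s - w v s‖ ≤ (K * dist u v) * exp (l * |s|) := fun s => by
      have h1 : ‖w u s - w v s‖ ≤ K * ‖exp (l * |s|) • u s - exp (l * |s|) • v s‖ := by
        simpa only [dist_eq_norm] using (hK s).dist_le_mul _ _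
      have h2 : ‖exp (l * |s|) • u s - exp (l * |s|) • v s‖ ≤ exp (l * |s|) * dist u v := by
        rw [← smul_sub, norm_smul, norm_of_nonneg (exp_pos _).le, ← dist_eq_norm]
        exact mul_le_mul_of_nonneg_left (dist_coe_le_dist s) (exp_pos _).le
      calc _ ≤ _ := h1
        _ ≤ K * (exp (l * |s|) * dist u v) := mul_le_mul_of_nonneg_left h2 K.2
        _ = _ := by ring
    have h2 : I u t - I v t = ∫ s in (0 : ℝ)..t, (w u s - w v s) := by
      rw [intervalIntegral.integral_sub ((hwc u).intervalIntegrable _ _)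
        ((hwc v).intervalIntegrable _ _)]
      simp [I]
    have h3 : dist (P u t) (P v t) = exp (-(l * |t|)) * ‖I u t - I v t‖ := by
      change dist (exp (-(l * |t|)) • I u t) (exp (-(l * |t|)) • I v t) = _
      rw [dist_eq_norm, ← smul_sub, norm_smul, norm_of_nonneg (exp_pos _).le]
    rw [h3, h2]
    calc _ ≤ exp (-(l * |t|)) * (K * dist u v / l * exp (l * |t|)) :=
          mul_le_mul_of_nonneg_left (norm_integral_le_exp hl0 (by positivity) h1 t) (exp_pos _).le
      _ = K * dist u v / l := hcancel _ _
      _ ≤ _ := by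
        have : (((1 / 2 : ℝ≥0)) : ℝ) = 1 / 2 := by norm_num
        rw [this, div_le_iff₀ hl0, hl]
        have := dist_nonneg (x := u) (y := v)
        nlinarith [K.2]
  have hfix : P (hP.fixedPoint P) = hP.fixedPoint P := hP.fixedPoint_isFixedPt
  set u := hP.fixedPoint P
  have hu : ∀ t, exp (l * |t|) • u t = I u t := fun t => by
    have : u t = exp (-(l * |t|)) • I u t := by
      conv_lhs => rw [← hfix]
      rfl
    rw [this, smul_smul, ← exp_add]; simp
  refine ⟨I u, by simp [I], fun t => ?_⟩
  have := hId u t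
  simp only [w, hu] at this
  exact this

/-- Grönwall's inequality for both directions of time: negative times reduce to positive ones by
reversing the curves and the field. -/
theorem dist_le_gronwallBound_abs {v : ℝ → E → E} {K : ℝ≥0} (hv : ∀ t, LipschitzWith K (v t))
    {f f' g : ℝ → E} {T ε δ : ℝ} (hf : ∀ t, HasDerivAt f (f' t) t)
    (hb : ∀ t, |t| ≤ T → dist (f' t) (v t (f t)) ≤ ε) (hg : ∀ t, HasDerivAt g (v t (g t)) t)
    (h0 : dist (f 0) (g 0) ≤ δ) {t : ℝ} (ht : |t| ≤ T) :
    dist (f t) (g t) ≤ gronwallBound δ K ε |t| := by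
  have hT : 0 ≤ T := (abs_nonneg t).trans ht
  rcases le_total 0 t with h | h
  · have := dist_le_of_approx_trajectories_ODE (a := 0) (b := T) (εg := 0) hv
      (continuous_iff_continuousAt.2 fun s => (hf s).continuousAt).continuousOn
      (fun s _ => (hf s).hasDerivWithinAt)
      (fun s hs => hb s (by rw [abs_of_nonneg hs.1]; exact hs.2.le))
      (continuous_iff_continuousAt.2 fun s => (hg s).continuousAt).continuousOn
      (fun s _ => (hg s).hasDerivWithinAt) (fun s _ => (dist_self _).le) h0 t
      ⟨h, (le_abs_self t).trans ht⟩
    rwa [add_zero, sub_zero, show gronwallBound δ K ε t = gronwallBound δ K ε |t| by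
      rw [abs_of_nonneg h]] at this
  · have hneg : ∀ {p : ℝ → E} {p' : E} {s : ℝ}, HasDerivAt p p' (-s) →
        HasDerivAt (fun s => p (-s)) (-p') s := fun {p p' s} hp => by
      simpa [Function.comp_def] using hp.scomp s (hasDerivAt_neg s)
    have hf2 : ∀ s, HasDerivAt (fun s => f (-s)) (-f' (-s)) s := fun s => hneg (hf (-s))
    have hg2 : ∀ s, HasDerivAt (fun s => g (-s)) (-v (-s) (g (-s))) s := fun s => hneg (hg (-s))
    have := dist_le_of_approx_trajectories_ODE (a := 0) (b := T) (εf := ε) (εg := 0) (δ := δ)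
      (v := fun s y => -v (-s) y) (K := K) (fun s => (hv (-s)).neg)
      (continuous_iff_continuousAt.2 fun s => (hf2 s).continuousAt).continuousOn
      (fun s _ => (hf2 s).hasDerivWithinAt)
      (fun s hs => by
        rw [dist_neg_neg]; exact hb (-s) (by rw [abs_neg, abs_of_nonneg hs.1]; exact hs.2.le))
      (continuous_iff_continuousAt.2 fun s => (hg2 s).continuousAt).continuousOn
      (fun s _ => (hg2 s).hasDerivWithinAt) (fun s _ => (dist_self _).le) (by simpa using h0) (-t)
      ⟨by linarith, (neg_le_abs t).trans ht⟩
    rwa [add_zero, sub_zero, neg_neg, ← abs_of_nonpos h] at this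

theorem gronwallBound_zero_left (K ε t : ℝ) :
    gronwallBound 0 K ε t = ε * gronwallBound 0 K 1 t := by
  unfold gronwallBound
  split_ifs <;> ring

/-- The flow of the globally Lipschitz vector field `V`. -/
structure IsLipschitzFlow (V : E → E) (K : ℝ≥0) (Y : ℝ → E → E) : Prop where
  lipschitz : LipschitzWith K V
  zero : ∀ x, Y 0 x = x
  deriv : ∀ x t, HasDerivAt (fun s => Y s x) (V (Y t x)) t

theorem exists_isLipschitzFlow [CompleteSpace E] {V : E → E} {K : ℝ≥0} (hV : LipschitzWith K V) :
    ∃ Y, IsLipschitzFlow V K Y := by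
  choose γ h0 hd using exists_global_solution (f := fun _ => V) (hV.continuous.comp continuous_snd)
    (fun _ => hV) (fun _ => le_rfl)
  exact ⟨fun t x => γ x t, hV, h0, hd⟩

namespace IsLipschitzFlow

variable {V : E → E} {K : ℝ≥0} {Y : ℝ → E → E}

theorem eq_of_hasDerivAt (h : IsLipschitzFlow V K Y) {γ : ℝ → E}
    (hγ : ∀ t, HasDerivAt γ (V (γ t)) t) (t : ℝ) : γ t = Y t (γ 0) := by
  have := ODE_solution_unique_univ (v := fun _ => V) (s := fun _ => univ) (t₀ := 0) (f := γ)
    (g := fun s => Y s (γ 0)) (fun _ => h.lipschitz.lipschitzOnWith)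
    (fun t => ⟨hγ t, trivial⟩) (fun t => ⟨h.deriv _ t, trivial⟩) (h.zero _).symm
  exact congrFun this t

theorem add (h : IsLipschitzFlow V K Y) (s t : ℝ) (x : E) : Y (s + t) x = Y s (Y t x) := by
  have := h.eq_of_hasDerivAt (γ := fun s => Y (s + t) x)
    (fun s => (h.deriv x (s + t)).comp_add_const s t) s
  simpa using this

theorem dist_le (h : IsLipschitzFlow V K Y) {t T : ℝ} (ht : |t| ≤ T) (x y : E) :
    dist (Y t x) (Y t y) ≤ dist x y * exp (K * T) := by
  have := dist_le_gronwallBound_abs (v := fun _ => V) (fun _ => h.lipschitz) (h.deriv x)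
    (T := T) (ε := 0) (δ := dist x y) (fun s _ => (dist_self _).le) (h.deriv y)
    (by simp [h.zero]) ht
  rw [gronwallBound_ε0] at this
  refine this.trans ?_
  gcongr

theorem continuous_time (h : IsLipschitzFlow V K Y) (x : E) : Continuous fun t => Y t x :=
  continuous_iff_continuousAt.2 fun t => (h.deriv x t).continuousAt

theorem continuous (h : IsLipschitzFlow V K Y) : Continuous fun z : ℝ × E => Y z.1 z.2 := by
  refine continuous_iff_continuousAt.2 fun ⟨t, x⟩ => ?_
  rw [ContinuousAt, tendsto_iff_dist_tendsto_zero]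
  have h1 : Tendsto (fun z : ℝ × E => dist z.2 x * exp (K * (|t| + 1)) + dist (Y z.1 x) (Y t x))
      (𝓝 (t, x)) (𝓝 0) := by
    have : Continuous fun z : ℝ × E =>
        dist z.2 x * exp (K * (|t| + 1)) + dist (Y z.1 x) (Y t x) := by
      have := h.continuous_time x
      fun_prop
    simpa using this.tendsto (t, x)
  refine squeeze_zero' (Eventually.of_forall fun _ => dist_nonneg) ?_ h1
  have : ∀ᶠ z : ℝ × E in 𝓝 (t, x), |z.1| < |t| + 1 :=
    (continuous_abs.comp continuous_fst).continuousAt.eventually_lt continuousAt_const (by simp)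
  filter_upwards [this] with z hz
  exact (dist_triangle _ (Y z.1 x) _).trans (add_le_add_left (h.dist_le hz.le _ _) _)

/-- The solutions of the variational equation are the derivatives of the flow. -/
theorem hasFDerivAt_of_variational (h : IsLipschitzFlow V K Y) (hd : Differentiable ℝ V)
    (hu : UniformContinuous (fderiv ℝ V)) {x : E} {M : ℝ → E →L[ℝ] E}
    (hM0 : M 0 = ContinuousLinearMap.id ℝ E)
    (hM : ∀ t, HasDerivAt M ((fderiv ℝ V (Y t x)).comp (M t)) t) (t : ℝ) :
    HasFDerivAt (Y t) (M t) x := by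
  rw [hasFDerivAt_iff_isLittleO_nhds_zero, Asymptotics.isLittleO_iff]
  intro c hc
  set T := |t|
  set G := gronwallBound 0 K 1 T
  have hG : 0 ≤ G := by
    have := gronwallBound_mono le_rfl zero_le_one K.2 (abs_nonneg t)
    rwa [gronwallBound_x0] at this
  -- The final error is `ε * exp (K * T) * G * ‖v‖`; the `G + 1` in the witness avoids division by
  -- zero.
  obtain ⟨ε, hε, hεc⟩ : ∃ ε > 0, ε * exp (K * T) * G ≤ c := by
    refine ⟨c / (exp (K * T) * (G + 1)), by positivity, ?_⟩
    have h1 : c / (exp (K * T) * (G + 1)) * exp (K * T) * G = c * (G / (G + 1)) := by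
      field_simp
    have h2 : G / (G + 1) ≤ 1 := (div_le_one (by linarith)).2 (by linarith)
    rw [h1]
    nlinarith
  obtain ⟨δ, hδ, hδV⟩ := Metric.uniformContinuous_iff.1 hu ε hε
  have hnear : ∀ᶠ v : E in 𝓝 0, ‖v‖ * exp (K * T) < δ := by
    have : Continuous fun v : E => ‖v‖ * exp (K * T) := by fun_prop
    exact this.continuousAt.eventually_lt continuousAt_const (by simpa using hδ)
  filter_upwards [hnear] with v hv
  -- The difference of two orbits solves the variational equation up to an error small compared with
  -- `‖v‖`, by the mean value inequality. Uniform continuity of `fderiv ℝ V` makes `δ` independent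
  -- of the point of the orbit.
  have hb : ∀ s, |s| ≤ T → dist (V (Y s (x + v)) - V (Y s x))
      (fderiv ℝ V (Y s x) (Y s (x + v) - Y s x)) ≤ ε * (‖v‖ * exp (K * T)) := by
    intro s hs
    have hd1 : dist (Y s (x + v)) (Y s x) ≤ ‖v‖ * exp (K * T) := by
      simpa using h.dist_le hs (x + v) x
    rw [dist_eq_norm]
    refine (Convex.norm_image_sub_le_of_norm_hasFDerivWithin_le' (𝕜 := ℝ)
      (s := Metric.closedBall (Y s x) (‖v‖ * exp (K * T))) (C := ε)
      (fun y _ => (hd y).hasFDerivAt.hasFDerivWithinAt) (fun y hy => ?_)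
      (convex_closedBall _ _) (Metric.mem_closedBall_self (by positivity)) hd1).trans ?_
    · rw [← dist_eq_norm]
      exact (hδV (lt_of_le_of_lt hy hv)).le
    · rw [← dist_eq_norm]
      exact mul_le_mul_of_nonneg_left hd1 hε.le
  have hlip : ∀ s, LipschitzWith K (fun y => fderiv ℝ V (Y s x) y) := fun s =>
    (fderiv ℝ V (Y s x)).lipschitz.weaken
      ((hd (Y s x)).hasFDerivAt.le_of_lipschitz h.lipschitz)
  have := dist_le_gronwallBound_abs (v := fun s y => fderiv ℝ V (Y s x) y) hlip
    (f := fun s => Y s (x + v) - Y s x) (g := fun s => M s v) (δ := 0)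
    (fun s => (h.deriv (x + v) s).sub (h.deriv x s)) hb
    (fun s => by
      simpa using (hM s).clm_apply (hasDerivAt_const s v))
    (by simp [h.zero, hM0]) le_rfl
  rw [gronwallBound_zero_left, dist_eq_norm] at this
  calc _ ≤ _ := this
    _ = (ε * exp (K * T) * G) * ‖v‖ := by ring
    _ ≤ c * ‖v‖ := by gcongr

/-- The variational equation is linear in the operator `M` with coefficient of norm at most `K`, so
it is itself a Lipschitz equation, in the space of operators. -/
theorem exists_variational [CompleteSpace E] (h : IsLipschitzFlow V K Y)
    (hd : Differentiable ℝ V) (hu : UniformContinuous (fderiv ℝ V)) (x : E) :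
    ∃ M : ℝ → E →L[ℝ] E, M 0 = ContinuousLinearMap.id ℝ E ∧
      ∀ t, HasDerivAt M ((fderiv ℝ V (Y t x)).comp (M t)) t := by
  have hK : ∀ y, ‖fderiv ℝ V y‖ ≤ K := fun y => (hd y).hasFDerivAt.le_of_lipschitz h.lipschitz
  refine exists_global_solution (K := K) (C := 0)
    (f := fun t (M : E →L[ℝ] E) => (fderiv ℝ V (Y t x)).comp M) ?_ (fun t => ?_) (by simp) _
  · have h1 : Continuous fun z : ℝ × (E →L[ℝ] E) => fderiv ℝ V (Y z.1 x) :=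
      hu.continuous.comp ((h.continuous_time x).comp continuous_fst)
    exact h1.clm_comp continuous_snd
  · refine LipschitzWith.of_dist_le_mul fun A B => ?_
    rw [dist_eq_norm, dist_eq_norm, ← ContinuousLinearMap.comp_sub]
    exact (ContinuousLinearMap.opNorm_comp_le _ _).trans
      (mul_le_mul_of_nonneg_right (hK _) (norm_nonneg _))

variable [CompleteSpace E]

theorem differentiable_space (h : IsLipschitzFlow V K Y) (hd : Differentiable ℝ V)
    (hu : UniformContinuous (fderiv ℝ V)) (t : ℝ) : Differentiable ℝ (Y t) := fun x => by
  obtain ⟨M, hM0, hM⟩ := h.exists_variational hd hu x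
  exact (h.hasFDerivAt_of_variational hd hu hM0 hM t).differentiableAt

theorem hasDerivAt_fderiv (h : IsLipschitzFlow V K Y) (hd : Differentiable ℝ V)
    (hu : UniformContinuous (fderiv ℝ V)) (x : E) (t : ℝ) :
    HasDerivAt (fun s => fderiv ℝ (Y s) x) ((fderiv ℝ V (Y t x)).comp (fderiv ℝ (Y t) x)) t := by
  obtain ⟨M, hM0, hM⟩ := h.exists_variational hd hu x
  have : (fun s => fderiv ℝ (Y s) x) = M :=
    funext fun s => (h.hasFDerivAt_of_variational hd hu hM0 hM s).fderiv
  rw [this, congrFun this t]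
  exact hM t

theorem norm_fderiv_le (h : IsLipschitzFlow V K Y) (hd : Differentiable ℝ V)
    (hu : UniformContinuous (fderiv ℝ V)) {t T : ℝ} (ht : |t| ≤ T) (x : E) :
    ‖fderiv ℝ (Y t) x‖ ≤ exp (K * T) := by
  have h1 : LipschitzWith ⟨exp (K * T), (exp_pos _).le⟩ (Y t) :=
    LipschitzWith.of_dist_le_mul fun y z => by
      rw [mul_comm]; exact h.dist_le ht y z
  exact (h.differentiable_space hd hu t x).hasFDerivAt.le_of_lipschitz h1

/-- Derivatives at nearby points solve linear equations with uniformly close coefficients, so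
Grönwall compares them at equal times. Continuity in time at a fixed point comes from the
variational equation. -/
theorem continuous_fderiv (h : IsLipschitzFlow V K Y) (hd : Differentiable ℝ V)
    (hu : UniformContinuous (fderiv ℝ V)) :
    Continuous fun z : ℝ × E => fderiv ℝ (Y z.1) z.2 := by
  have hK : ∀ y, ‖fderiv ℝ V y‖ ≤ K := fun y => (hd y).hasFDerivAt.le_of_lipschitz h.lipschitz
  refine continuous_iff_continuousAt.2 fun ⟨t, x⟩ => Metric.continuousAt_iff'.2 fun c hc => ?_
  set T := |t| + 1
  set G := gronwallBound 0 K 1 T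
  have hG : 0 ≤ G := by
    have := gronwallBound_mono le_rfl zero_le_one K.2 (show (0 : ℝ) ≤ T by positivity)
    rwa [gronwallBound_x0] at this
  obtain ⟨ε, hε, hεc⟩ : ∃ ε > 0, ε * exp (K * T) * G < c / 2 := by
    refine ⟨c / 2 / (exp (K * T) * (G + 1)), by positivity, ?_⟩
    have h1 : c / 2 / (exp (K * T) * (G + 1)) * exp (K * T) * G = c / 2 * (G / (G + 1)) := by
      field_simp
    have h2 : G / (G + 1) < 1 := (div_lt_one (by linarith)).2 (by linarith)
    rw [h1]
    nlinarith
  obtain ⟨δ, hδ, hδV⟩ := Metric.uniformContinuous_iff.1 hu ε hε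
  have e1 : ∀ᶠ z : ℝ × E in 𝓝 (t, x), |z.1| < T :=
    (continuous_abs.comp continuous_fst).continuousAt.eventually_lt continuousAt_const
      (by simp [T])
  have e2 : ∀ᶠ z : ℝ × E in 𝓝 (t, x), dist z.2 x * exp (K * T) < δ := by
    have : Continuous fun z : ℝ × E => dist z.2 x * exp (K * T) := by fun_prop
    exact this.continuousAt.eventually_lt continuousAt_const (by simpa using hδ)
  have e3 : ∀ᶠ z : ℝ × E in 𝓝 (t, x),
      dist (fderiv ℝ (Y z.1) x) (fderiv ℝ (Y t) x) < c / 2 := by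
    have h1 : ContinuousAt (fun s => fderiv ℝ (Y s) x) t :=
      (h.hasDerivAt_fderiv hd hu x t).continuousAt
    have h2 : ContinuousAt (fun z : ℝ × E => fderiv ℝ (Y z.1) x) (t, x) :=
      ContinuousAt.comp (f := Prod.fst) (x := (t, x)) h1 continuousAt_fst
    exact Metric.continuousAt_iff'.1 h2 _ (by positivity)
  filter_upwards [e1, e2, e3] with z h1 h2 h3
  have hb : ∀ s, |s| ≤ T → dist ((fderiv ℝ V (Y s z.2)).comp (fderiv ℝ (Y s) z.2))
      ((fderiv ℝ V (Y s x)).comp (fderiv ℝ (Y s) z.2)) ≤ ε * exp (K * T) := by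
    intro s hs
    rw [dist_eq_norm, ← ContinuousLinearMap.sub_comp]
    refine (ContinuousLinearMap.opNorm_comp_le _ _).trans
      (mul_le_mul ?_ (h.norm_fderiv_le hd hu hs _) (norm_nonneg _) hε.le)
    rw [← dist_eq_norm]
    exact (hδV ((h.dist_le hs _ _).trans_lt h2)).le
  have hlip : ∀ s, LipschitzWith K (fun A : E →L[ℝ] E => (fderiv ℝ V (Y s x)).comp A) :=
    fun s => LipschitzWith.of_dist_le_mul fun A B => by
      rw [dist_eq_norm, dist_eq_norm, ← ContinuousLinearMap.comp_sub]
      exact (ContinuousLinearMap.opNorm_comp_le _ _).trans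
        (mul_le_mul_of_nonneg_right (hK _) (norm_nonneg _))
  have h0 : Y 0 = id := funext h.zero
  have h4 := dist_le_gronwallBound_abs hlip (δ := 0) (h.hasDerivAt_fderiv hd hu z.2) hb
    (h.hasDerivAt_fderiv hd hu x) (by simp [h0]) h1.le
  have h5 : gronwallBound 0 K (ε * exp (K * T)) |z.1| ≤ ε * exp (K * T) * G :=
    (gronwallBound_mono le_rfl (by positivity) K.2 h1.le).trans (gronwallBound_zero_left _ _ _).le
  calc _ ≤ dist (fderiv ℝ (Y z.1) z.2) (fderiv ℝ (Y z.1) x)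
        + dist (fderiv ℝ (Y z.1) x) (fderiv ℝ (Y t) x) := dist_triangle _ _ _
    _ < c := by linarith

theorem contDiff (h : IsLipschitzFlow V K Y) (hd : Differentiable ℝ V)
    (hu : UniformContinuous (fderiv ℝ V)) : ContDiff ℝ 1 fun z : ℝ × E => Y z.1 z.2 := by
  let f₁ : ℝ → E → ℝ →L[ℝ] E := fun t x => ContinuousLinearMap.toSpanSingleton ℝ (V (Y t x))
  let f₂ : ℝ → E → E →L[ℝ] E := fun t x => fderiv ℝ (Y t) x
  have c₁ : Continuous fun z : ℝ × E => f₁ z.1 z.2 :=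
    (ContinuousLinearMap.toSpanSingletonCLE (𝕜 := ℝ) (E := E)).continuous.comp
      (h.lipschitz.continuous.comp h.continuous)
  have c₂ : Continuous fun z : ℝ × E => f₂ z.1 z.2 := h.continuous_fderiv hd hu
  have key : ∀ z : ℝ × E,
      HasFDerivAt (fun z : ℝ × E => Y z.1 z.2) ((f₁ z.1 z.2).coprod (f₂ z.1 z.2)) z := fun z =>
    (hasStrictFDerivAt_uncurry_coprod (f := Y) (f₁ := f₁) (f₂ := f₂)
      (Eventually.of_forall fun w => (h.deriv w.2 w.1).hasFDerivAt)
      (Eventually.of_forall fun w => (h.differentiable_space hd hu w.1 w.2).hasFDerivAt)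
      c₁.continuousAt c₂.continuousAt).hasFDerivAt
  refine contDiff_one_iff_hasFDerivAt.2 ⟨_, ?_, key⟩
  have : (fun z : ℝ × E => (f₁ z.1 z.2).coprod (f₂ z.1 z.2)) = fun z =>
      (f₁ z.1 z.2).comp (ContinuousLinearMap.fst ℝ ℝ E) +
        (f₂ z.1 z.2).comp (ContinuousLinearMap.snd ℝ ℝ E) := by
    ext z <;> simp
  rw [this]
  exact (c₁.clm_comp continuous_const).add (c₂.clm_comp continuous_const)

end IsLipschitzFlow

end LipschitzODE

/-! ### Determinants of the derivative of a divergence-free flow. -/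

section LiouvilleTheorem

open scoped NNReal

variable {E : Type*} [NormedAddCommGroup E] [NormedSpace ℝ E] [FiniteDimensional ℝ E]

theorem ContinuousLinearMap.differentiable_det : Differentiable ℝ fun f : E →L[ℝ] E => f.det := by
  classical
  let b := Module.finBasis ℝ E
  have h1 : (fun f : E →L[ℝ] E => f.det) = fun f : E →L[ℝ] E =>
      ∑ σ : Equiv.Perm (Fin (Module.finrank ℝ E)), (Equiv.Perm.sign σ : ℝ) *
        ∏ i, (b.coord (σ i)).toContinuousLinearMap (f (b i)) := by
    funext f
    rw [ContinuousLinearMap.det, ← LinearMap.det_toMatrix b, Matrix.det_apply']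
    simp [LinearMap.toMatrix_apply]
  rw [h1]
  intro f
  refine DifferentiableAt.fun_sum fun σ _ => DifferentiableAt.const_mul ?_ _
  exact (HasFDerivAt.finsetProd fun i _ => DifferentiableAt.hasFDerivAt
    (f := fun f : E →L[ℝ] E => (b.coord (σ i)).toContinuousLinearMap (f (b i)))
    (by fun_prop)).differentiableAt

theorem ContinuousLinearMap.hasDerivAt_det_one_add_smul (A : E →L[ℝ] E) :
    HasDerivAt (fun r : ℝ => (ContinuousLinearMap.id ℝ E + r • A).det)
      (LinearMap.trace ℝ E A) 0 := by
  classical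
  let b := Module.finBasis ℝ E
  let N := LinearMap.toMatrix b b (A : E →ₗ[ℝ] E)
  let p := (Matrix.det (1 + (Polynomial.X : Polynomial ℝ) • N.map Polynomial.C)).divX.divX
  have h1 : (fun r : ℝ => (ContinuousLinearMap.id ℝ E + r • A).det) =
      fun r => 1 + N.trace * r + p.eval r * r ^ 2 := by
    funext r
    rw [ContinuousLinearMap.det, ← LinearMap.det_toMatrix b, ← Matrix.det_one_add_smul]
    simp [N]
  rw [h1, LinearMap.trace_eq_matrix_trace ℝ b]
  have h2 : HasDerivAt (fun r : ℝ => p.eval r * r ^ 2) 0 0 := by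
    simpa using (p.hasDerivAt 0).fun_mul (hasDerivAt_pow 2 (0 : ℝ))
  simpa using (((hasDerivAt_id' (0 : ℝ)).const_mul N.trace).const_add 1).fun_add h2

/-- By the chain rule the derivative depends only on the velocity `A`, so it may be computed on the
affine curve `id + r • A`. -/
theorem HasDerivAt.det_of_eq_id {N : ℝ → E →L[ℝ] E} {A : E →L[ℝ] E} (hN : HasDerivAt N A 0)
    (h0 : N 0 = ContinuousLinearMap.id ℝ E) :
    HasDerivAt (fun s => (N s).det) (LinearMap.trace ℝ E A) 0 := by
  have h1 : ∀ {c : ℝ → E →L[ℝ] E}, HasDerivAt c A 0 → c 0 = ContinuousLinearMap.id ℝ E →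
      HasDerivAt (fun s => (c s).det) (fderiv ℝ (fun f : E →L[ℝ] E => f.det)
        (ContinuousLinearMap.id ℝ E) A) 0 := fun {c} hc hc0 => by
    have h2 := (ContinuousLinearMap.differentiable_det (c 0)).hasFDerivAt.comp_hasDerivAt 0 hc
    rw [hc0] at h2
    exact h2
  have h2 : HasDerivAt (fun r : ℝ => ContinuousLinearMap.id ℝ E + r • A) A 0 := by
    simpa using ((hasDerivAt_id (0 : ℝ)).smul_const A).const_add (ContinuousLinearMap.id ℝ E)
  rw [← (h1 h2 (by simp)).unique (ContinuousLinearMap.hasDerivAt_det_one_add_smul A)]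
  exact h1 hN h0

/-- Liouville's theorem: the flow of a field of zero divergence preserves the volume. -/
theorem IsLipschitzFlow.det_fderiv_eq_one {V : E → E} {K : ℝ≥0} {Y : ℝ → E → E}
    (h : IsLipschitzFlow V K Y) (hd : Differentiable ℝ V) (hu : UniformContinuous (fderiv ℝ V))
    (htr : ∀ x, LinearMap.trace ℝ E (fderiv ℝ V x) = 0) (t : ℝ) (x : E) :
    (fderiv ℝ (Y t) x).det = 1 := by
  have := FiniteDimensional.complete ℝ E
  have h0 : Y 0 = id := funext h.zero
  have hdiff := h.differentiable_space hd hu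
  -- The group law reduces the derivative of the Jacobian at any time to time zero, where the flow
  -- is the identity and the trace formula applies.
  have hmul : ∀ s t, (fderiv ℝ (Y (s + t)) x).det =
      (fderiv ℝ (Y s) (Y t x)).det * (fderiv ℝ (Y t) x).det := fun s t => by
    have h1 : Y (s + t) = Y s ∘ Y t := funext fun y => h.add s t y
    rw [h1, fderiv_comp x (hdiff s _) (hdiff t x)]
    exact LinearMap.det_comp _ _
  have hderiv : ∀ t, HasDerivAt (fun s => (fderiv ℝ (Y s) x).det) 0 t := fun t => by
    have h1 := (h.hasDerivAt_fderiv hd hu (Y t x) 0).det_of_eq_id (by simp [h0])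
    have h2 : LinearMap.trace ℝ E
        ((fderiv ℝ V (Y 0 (Y t x))).comp (fderiv ℝ (Y 0) (Y t x)) : E →L[ℝ] E) = 0 := by
      rw [h0, fderiv_id, ContinuousLinearMap.comp_id]
      exact htr _
    rw [h2] at h1
    have h3 := h1.mul_const (fderiv ℝ (Y t) x).det
    simp only [← hmul, zero_mul] at h3
    have h4 : HasDerivAt (fun s => (fderiv ℝ (Y (s + t)) x).det) 0 (t - t) := by
      rwa [sub_self]
    simpa using h4.comp_sub_const t t
  have := is_const_of_deriv_eq_zero (fun t => (hderiv t).differentiableAt)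
    (fun t => (hderiv t).deriv) t 0
  simpa [h0, ContinuousLinearMap.det] using this

end LiouvilleTheorem

/-! ### Lower bound and cutoff of the hard-core potential. -/

section Potential

variable {Φ : ℝ → ℝ} {σ R : ℝ}

theorem isOpen_outside_core (σ : ℝ) : IsOpen {q : ℝ | σ < |q|} :=
  isOpen_lt continuous_const continuous_abs

theorem IsCorePotential.exists_lt_near_core (hΦ : IsCorePotential Φ σ R) (c : ℝ) :
    ∃ δ > 0, ∀ q, σ < |q| → |q| < σ + δ → c < Φ q := by
  have h1 := hΦ.core.eventually (eventually_gt_atTop c)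
  rw [eventually_comap] at h1
  obtain ⟨u, hu, h2⟩ := mem_nhdsGT_iff_exists_Ioo_subset.1 h1
  exact ⟨u - σ, sub_pos.2 hu, fun q h3 h4 => h2 (show |q| ∈ Ioo σ u from ⟨h3, by linarith⟩) q rfl⟩

theorem IsCorePotential.contDiffAt (hΦ : IsCorePotential Φ σ R) {q : ℝ} (hq : σ < |q|) :
    ContDiffAt ℝ 2 Φ q :=
  hΦ.contDiffOn.contDiffAt ((isOpen_outside_core σ).mem_nhds hq)

/-- Near the core the potential is positive, beyond the range it is zero, and the remaining region
is compact. -/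
theorem IsCorePotential.exists_lower_bound (hΦ : IsCorePotential Φ σ R) :
    ∃ C, 0 ≤ C ∧ ∀ q, σ < |q| → -C ≤ Φ q := by
  obtain ⟨δ, hδ, h1⟩ := hΦ.exists_lt_near_core 0
  have hK : IsCompact (Metric.closedBall (0 : ℝ) R ∩ {q | σ + δ ≤ |q|}) :=
    (isCompact_closedBall _ _).inter_right (isClosed_le continuous_const continuous_abs)
  have hc : ContinuousOn Φ (Metric.closedBall (0 : ℝ) R ∩ {q | σ + δ ≤ |q|}) :=
    hΦ.contDiffOn.continuousOn.mono fun q hq => by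
      have := hq.2
      simp only [mem_ofPred_eq] at this ⊢
      linarith
  obtain ⟨C, hC⟩ := (hK.bddBelow_image hc)
  refine ⟨|C|, abs_nonneg _, fun q hq => ?_⟩
  rcases lt_or_ge (|q|) (σ + δ) with h | h
  · linarith [h1 q hq h, abs_nonneg C]
  rcases lt_or_ge R (|q|) with h2 | h2
  · rw [hΦ.eq_zero q h2]; linarith [abs_nonneg C]
  · have := hC (mem_image_of_mem Φ (show q ∈ Metric.closedBall (0 : ℝ) R ∩ {q | σ + δ ≤ |q|} from
      ⟨by simpa using h2, h⟩))
    linarith [neg_abs_le C]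

/-- A potential without core which agrees with `Φ` on the left of the core, except for a region
where both are high. -/
structure IsCutoff (Φ : ℝ → ℝ) (σ c ρ : ℝ) (Ψ : ℝ → ℝ) : Prop where
  lt : ρ < -σ
  contDiff : ContDiff ℝ 2 Ψ
  hasCompactSupport : HasCompactSupport (deriv Ψ)
  eq : ∀ q < ρ, Ψ q = Φ q
  high : ∀ q, ρ ≤ q → c < Ψ q
  high_core : ∀ q, ρ ≤ q → q < -σ → c < Φ q

/-- Interpolate smoothly from `Φ` to the constant `c + 1` on the window from `-σ - δ / 2` to `-σ - δ
/ 4`. There `Φ > c`, so every convex combination also exceeds `c`. Only negative arguments matter,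
since `q_j - q_{j+1}` is negative in allowed configurations. -/
theorem IsCorePotential.exists_isCutoff (hΦ : IsCorePotential Φ σ R) (hσ : 0 < σ) (c : ℝ) :
    ∃ ρ Ψ, IsCutoff Φ σ c ρ Ψ := by
  obtain ⟨δ, hδ, h1⟩ := hΦ.exists_lt_near_core c
  have hcore : ∀ q, -σ - δ / 2 ≤ q → q < -σ → c < Φ q := fun q hq hq' =>
    h1 q (by rw [abs_of_neg (by linarith)]; linarith) (by rw [abs_of_neg (by linarith)]; linarith)
  let χ : ℝ → ℝ := fun q => Real.smoothTransition ((q - (-σ - δ / 2)) / (δ / 4))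
  have hχ : ContDiff ℝ 2 χ := by
    have : ContDiff ℝ 2 fun q : ℝ => (q - (-σ - δ / 2)) / (δ / 4) := by fun_prop
    exact Real.smoothTransition.contDiff.comp this
  have hχ0 : ∀ q ≤ -σ - δ / 2, χ q = 0 := fun q hq =>
    Real.smoothTransition.zero_of_nonpos
      (div_nonpos_of_nonpos_of_nonneg (by linarith) (by linarith))
  have hχ1 : ∀ q, -σ - δ / 4 ≤ q → χ q = 1 := fun q hq =>
    Real.smoothTransition.one_of_one_le ((one_le_div (by linarith)).2 (by linarith))
  let Ψ : ℝ → ℝ := fun q => (1 - χ q) * Φ q + χ q * (c + 1)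
  have hright : ∀ q, -σ - δ / 4 < q → Ψ =ᶠ[𝓝 q] fun _ => c + 1 := fun q hq => by
    filter_upwards [lt_mem_nhds hq] with r hr
    simp [Ψ, hχ1 r hr.le]
  have hleft : ∀ q ≤ -σ - δ / 2, Ψ q = Φ q := fun q hq => by simp [Ψ, hχ0 q hq]
  refine ⟨-σ - δ / 2, Ψ, by linarith, ?_, ?_, fun q hq => hleft q hq.le, fun q hq => ?_, hcore⟩
  · rw [contDiff_iff_contDiffAt]
    intro q
    rcases lt_or_ge (-σ - δ / 4) q with h | h
    · exact contDiffAt_const.congr_of_eventuallyEq (hright q h)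
    · have hq : σ < |q| := by rw [abs_of_neg (by linarith)]; linarith
      exact ((contDiffAt_const.sub hχ.contDiffAt).mul (hΦ.contDiffAt hq)).add
        (hχ.contDiffAt.mul contDiffAt_const)
  · refine HasCompactSupport.of_support_subset_isCompact
      (isCompact_Icc (a := min (-R) (-σ - δ / 2)) (b := -σ - δ / 4)) fun q hq => ?_
    by_contra hcon
    apply hq
    rw [mem_Icc, not_and_or, not_le, not_le] at hcon
    rcases hcon with h | h
    · have : Ψ =ᶠ[𝓝 q] fun _ => 0 := by
        filter_upwards [gt_mem_nhds h] with r hr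
        rw [lt_min_iff] at hr
        rw [hleft r hr.2.le, hΦ.eq_zero r]
        exact lt_of_lt_of_le (by linarith [hr.1]) (neg_le_abs r)
      rw [this.deriv_eq]; simp
    · rw [(hright q h).deriv_eq]; simp
  · rcases lt_or_ge q (-σ) with h | h
    · have h2 := hcore q hq h
      have h3 : 0 ≤ χ q := Real.smoothTransition.nonneg _
      have h4 : χ q ≤ 1 := Real.smoothTransition.le_one _
      change c < (1 - χ q) * Φ q + χ q * (c + 1)
      rcases h4.lt_or_eq with h5 | h5
      · nlinarith [mul_lt_mul_of_pos_left h2 (sub_pos.2 h5)]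
      · rw [h5]; linarith
    · rw [(hright q (by linarith)).eq_of_nhds]; linarith

theorem IsCutoff.deriv_eq {Ψ : ℝ → ℝ} {c ρ : ℝ} (h : IsCutoff Φ σ c ρ Ψ) {q : ℝ} (hq : q < ρ) :
    deriv Ψ q = deriv Φ q := by
  refine EventuallyEq.deriv_eq ?_
  filter_upwards [gt_mem_nhds hq] with r hr using h.eq r hr

end Potential

/-! ### Motion in which a chosen set of neighbouring pairs interacts. -/

section Mechanics

variable {n : ℕ}

/-- The difference `q_j - q_{j+1}` of the positions of a pair of nearest neighbours. -/
def gap (j : Fin (n - 1)) : Phase n →L[ℝ] ℝ :=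
  (ContinuousLinearMap.fst ℝ ℝ ℝ).comp (ContinuousLinearMap.proj (leftOf j)) -
    (ContinuousLinearMap.fst ℝ ℝ ℝ).comp (ContinuousLinearMap.proj (rightOf j))

/-- The momentum of a particle. -/
def momentum (i : Fin n) : Phase n →L[ℝ] ℝ :=
  (ContinuousLinearMap.snd ℝ ℝ ℝ).comp (ContinuousLinearMap.proj i)

@[simp]
theorem gap_apply (j : Fin (n - 1)) (x : Phase n) :
    gap j x = (x (leftOf j)).1 - (x (rightOf j)).1 := rfl

@[simp]
theorem momentum_apply (i : Fin n) (x : Phase n) : momentum i x = (x i).2 := rfl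

/-- The direction in which a pair of neighbours is accelerated by its interaction. -/
def gapDir (j : Fin (n - 1)) : Phase n := dirP (rightOf j) - dirP (leftOf j)

/-- Forces depend on positions but change momenta, and velocities depend on momenta but change
positions: this and `momentum_dirQ` make the field divergence free. -/
theorem gap_gapDir (j k : Fin (n - 1)) : gap j (gapDir k) = 0 := by
  simp only [gap_apply, gapDir, dirP, Pi.sub_apply, Prod.fst_sub, Pi.single_apply]
  split_ifs <;> simp

theorem momentum_dirQ (i k : Fin n) : momentum i (dirQ k) = 0 := by
  simp only [momentum_apply, dirQ, Pi.single_apply]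
  split_ifs <;> simp

/-- The field of the particles in which only the pairs in `J` interact, by the force `-ψ`. -/
def pairField (ψ : ℝ → ℝ) (J : Finset (Fin (n - 1))) (x : Phase n) : Phase n :=
  ∑ i, momentum i x • dirQ i + ∑ j ∈ J, ψ (gap j x) • gapDir j

/-- The energy of the particles in which only the pairs in `J` interact. -/
noncomputable def pairEnergy (Φ : ℝ → ℝ) (J : Finset (Fin (n - 1))) (x : Phase n) : ℝ :=
  ∑ i, momentum i x ^ 2 / 2 + ∑ j ∈ J, Φ (gap j x)

/-- The configurations in which the pairs in `J` are at distance more than `σ`. -/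
def pairAllowed (σ : ℝ) (J : Finset (Fin (n - 1))) : Set (Phase n) :=
  {x | ∀ j ∈ J, gap j x < -σ}

theorem isOpen_pairAllowed (σ : ℝ) (J : Finset (Fin (n - 1))) : IsOpen (pairAllowed σ J) := by
  have : pairAllowed σ J = ⋂ j ∈ J, {x | gap j x < -σ} := by ext; simp [pairAllowed]
  rw [this]
  exact isOpen_biInter_finset fun j _ => isOpen_lt (gap j).continuous continuous_const

theorem pairAllowed_univ (σ : ℝ) : pairAllowed σ (Finset.univ : Finset (Fin (n - 1))) = allowed σ n := by
  ext x
  simp only [pairAllowed, allowed, mem_ofPred_eq, Finset.mem_univ, true_imp_iff, gap_apply]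
  exact forall_congr' fun j => by constructor <;> intro h <;> linarith

theorem pairAllowed_anti {σ : ℝ} {I J : Finset (Fin (n - 1))} (h : I ⊆ J) :
    pairAllowed σ J ⊆ pairAllowed σ I := fun _ hx j hj => hx j (h hj)

theorem allowed_subset_pairAllowed (σ : ℝ) (J : Finset (Fin (n - 1))) :
    allowed σ n ⊆ pairAllowed σ J := by
  rw [← pairAllowed_univ]; exact pairAllowed_anti (Finset.subset_univ J)

theorem pairField_apply (ψ : ℝ → ℝ) (J : Finset (Fin (n - 1))) (x : Phase n) (i : Fin n) :
    pairField ψ J x i = ((x i).2, ∑ j ∈ J, ψ (gap j x) *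
      ((if i = rightOf j then 1 else 0) - if i = leftOf j then 1 else 0)) := by
  have h1 : ∀ k : Fin n, (dirP k : Phase n) i = (0, if i = k then 1 else 0) := fun k => by
    rw [dirP, Pi.single_apply]; split_ifs <;> rfl
  have h2 : ∀ k : Fin n, (dirQ k : Phase n) i = (if i = k then 1 else 0, 0) := fun k => by
    rw [dirQ, Pi.single_apply]; split_ifs <;> rfl
  ext
  · simp [pairField, gapDir, Finset.sum_apply, Prod.fst_sum, h1, h2]
  · simp [pairField, gapDir, Finset.sum_apply, Prod.snd_sum, h1, h2]

theorem hasFDerivAt_pairField {ψ : ℝ → ℝ} (J : Finset (Fin (n - 1))) {x : Phase n}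
    (hψ : ∀ j ∈ J, DifferentiableAt ℝ ψ (gap j x)) :
    HasFDerivAt (pairField ψ J) (∑ i, (momentum i).smulRight (dirQ i) +
      ∑ j ∈ J, (deriv ψ (gap j x) • gap j).smulRight (gapDir j)) x := by
  refine HasFDerivAt.add (HasFDerivAt.fun_sum fun i _ => ?_) (HasFDerivAt.fun_sum fun j hj => ?_)
  · exact (momentum i).hasFDerivAt.smul_const (dirQ i)
  · exact ((hψ j hj).hasDerivAt.comp_hasFDerivAt x (gap j).hasFDerivAt).smul_const (gapDir j)

theorem trace_fderiv_pairField {ψ : ℝ → ℝ} (J : Finset (Fin (n - 1))) {x : Phase n}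
    (hψ : ∀ j ∈ J, DifferentiableAt ℝ ψ (gap j x)) :
    LinearMap.trace ℝ (Phase n) (fderiv ℝ (pairField ψ J) x) = 0 := by
  have h1 : ∀ (f : Phase n →L[ℝ] ℝ) (v : Phase n),
      LinearMap.trace ℝ (Phase n) (f.smulRight v : Phase n →L[ℝ] Phase n) = f v := fun f v =>
    LinearMap.trace_smulRight (f : Phase n →ₗ[ℝ] ℝ) v
  rw [(hasFDerivAt_pairField J hψ).fderiv]
  simp only [ContinuousLinearMap.toLinearMap_add, ContinuousLinearMap.toLinearMap_sum, map_add,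
    map_sum, h1, momentum_dirQ, smul_apply, gap_gapDir]
  simp

theorem contDiff_pairField {ψ : ℝ → ℝ} (hψ : ContDiff ℝ 1 ψ) (J : Finset (Fin (n - 1))) :
    ContDiff ℝ 1 (pairField ψ J) := by
  unfold pairField
  refine ContDiff.add (ContDiff.sum fun i _ => (momentum i).contDiff.smul contDiff_const)
    (ContDiff.sum fun j _ => (hψ.comp (gap j).contDiff).smul contDiff_const)

/-- The derivative is a constant operator plus constant operators multiplied by values of `deriv ψ`,
a compactly supported continuous function of one variable. -/
theorem uniformContinuous_fderiv_pairField {ψ : ℝ → ℝ} (hψ : ContDiff ℝ 1 ψ)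
    (hc : HasCompactSupport ψ) (J : Finset (Fin (n - 1))) :
    UniformContinuous (fderiv ℝ (pairField (n := n) ψ J)) := by
  have h1 : fderiv ℝ (pairField (n := n) ψ J) = fun x => ∑ i, (momentum i).smulRight (dirQ i) +
      ∑ j ∈ J, (deriv ψ (gap j x) • gap j).smulRight (gapDir j) := funext fun x =>
    (hasFDerivAt_pairField J fun j _ => (hψ.differentiable one_ne_zero) _).fderiv
  have h2 : UniformContinuous (deriv ψ) :=
    hc.deriv.uniformContinuous_of_continuous (hψ.continuous_deriv le_rfl)
  rw [h1]
  clear h1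
  refine uniformContinuous_const.add ?_
  induction J using Finset.induction_on with
  | empty => simpa using uniformContinuous_const
  | insert j J hj ih =>
    simp only [Finset.sum_insert hj]
    refine UniformContinuous.add ?_ ih
    have h3 : (fun x => (deriv ψ (gap j x) • gap j).smulRight (gapDir j)) = fun x : Phase n =>
        ContinuousLinearMap.toSpanSingleton ℝ ((gap j).smulRight (gapDir j))
          (deriv ψ (gap j x)) := by
      ext x : 2
      simp [mul_smul]
    rw [h3]
    exact (ContinuousLinearMap.uniformContinuous _).comp
      (h2.comp (ContinuousLinearMap.uniformContinuous _))

theorem exists_lipschitzWith_pairField {ψ : ℝ → ℝ} (hψ : ContDiff ℝ 1 ψ)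
    (hc : HasCompactSupport ψ) (J : Finset (Fin (n - 1))) :
    ∃ K, LipschitzWith K (pairField (n := n) ψ J) := by
  obtain ⟨L, hL⟩ := hψ.lipschitzWith_of_hasCompactSupport hc one_ne_zero
  induction J using Finset.induction_on with
  | empty =>
    have h1 : pairField ψ ∅ = (∑ i, (momentum i).smulRight (dirQ i) : Phase n →L[ℝ] Phase n) := by
      ext x : 1
      simp [pairField]
    exact ⟨_, h1 ▸ ContinuousLinearMap.lipschitz _⟩
  | insert j J hj ih =>
    obtain ⟨K, hK⟩ := ih
    have h1 : pairField ψ (insert j J) = fun x : Phase n => pairField ψ J x +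
        ContinuousLinearMap.toSpanSingleton ℝ (gapDir j) (ψ (gap j x)) := by
      ext x : 1
      simp only [pairField, Finset.sum_insert hj, ContinuousLinearMap.toSpanSingleton_apply]
      abel
    rw [h1]
    exact ⟨_, hK.add ((ContinuousLinearMap.lipschitz _).comp
      (hL.comp (ContinuousLinearMap.lipschitz _)))⟩

/-- Conservation of energy. -/
theorem pairEnergy_eq_of_hasDerivAt {Φ : ℝ → ℝ} {J : Finset (Fin (n - 1))} {γ : ℝ → Phase n}
    (hΦ : ∀ t, ∀ j ∈ J, DifferentiableAt ℝ Φ (gap j (γ t)))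
    (hγ : ∀ t, HasDerivAt γ (pairField (deriv Φ) J (γ t)) t) (t : ℝ) :
    pairEnergy Φ J (γ t) = pairEnergy Φ J (γ 0) := by
  have h1 : ∀ t, HasDerivAt (fun s => pairEnergy Φ J (γ s)) 0 t := fun t => by
    have h2 : HasDerivAt (fun s => pairEnergy Φ J (γ s))
        (∑ i, momentum i (γ t) * momentum i (pairField (deriv Φ) J (γ t)) +
          ∑ j ∈ J, deriv Φ (gap j (γ t)) * gap j (pairField (deriv Φ) J (γ t))) t := by
      refine HasDerivAt.fun_add (HasDerivAt.fun_sum fun i _ => ?_) (HasDerivAt.fun_sum fun j hj => ?_)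
      · have h3 := (((momentum i).hasFDerivAt.comp_hasDerivAt t (hγ t)).fun_pow 2).div_const 2
        refine h3.congr_deriv ?_
        simp
        ring
      · exact (hΦ t j hj).hasDerivAt.comp t ((gap j).hasFDerivAt.comp_hasDerivAt t (hγ t))
    convert h2 using 1
    -- After exchanging the sums, the work done by each pair force cancels the change of the
    -- potential energy of that pair.
    simp only [momentum_apply, gap_apply, pairField_apply, Finset.mul_sum]
    rw [Finset.sum_comm, ← Finset.sum_add_distrib]
    refine (Finset.sum_eq_zero fun j _ => ?_).symm
    simp only [mul_sub, mul_ite, mul_one, mul_zero, Finset.sum_sub_distrib, Finset.sum_ite_eq',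
      Finset.mem_univ, if_true]
    ring
  exact is_const_of_deriv_eq_zero (fun t => (h1 t).differentiableAt) (fun t => (h1 t).deriv) t 0

/-- The kinetic energy is nonnegative and every other pair contributes at least `-C`, so a bound on
the total energy bounds each single interaction. -/
theorem lt_of_pairEnergy_lt {F : ℝ → ℝ} {J : Finset (Fin (n - 1))} {x : Phase n} {C e : ℝ}
    (hF : ∀ j ∈ J, -C ≤ F (gap j x)) (hC : 0 ≤ C) (hx : pairEnergy F J x < e) {j : Fin (n - 1)}
    (hj : j ∈ J) : F (gap j x) < e + J.card * C := by
  have h1 : 0 ≤ ∑ i, momentum i x ^ 2 / 2 := Finset.sum_nonneg fun i _ => by positivity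
  have h2 : ∑ k ∈ J.erase j, -C ≤ ∑ k ∈ J.erase j, F (gap k x) :=
    Finset.sum_le_sum fun k hk => hF k (Finset.mem_of_mem_erase hk)
  have h3 := Finset.add_sum_erase J (fun k => F (gap k x)) hj
  rw [Finset.sum_const, nsmul_eq_mul] at h2
  have h4 : ((J.erase j).card : ℝ) * C ≤ J.card * C := by
    gcongr
    exact Finset.erase_subset _ _
  unfold pairEnergy at hx
  linarith

/-- A cutoff of the potential which does not affect the motion of energy below `e`. -/
theorem IsCorePotential.exists_pair_cutoff {Φ : ℝ → ℝ} {σ R : ℝ} (hΦ : IsCorePotential Φ σ R)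
    (hσ : 0 < σ) (J : Finset (Fin (n - 1))) {e : ℝ} (he : 0 ≤ e) :
    ∃ c ρ Ψ, IsCutoff Φ σ c ρ Ψ ∧
      (∀ x ∈ pairAllowed σ J, pairEnergy Φ J x < e → ∀ j ∈ J, gap j x < ρ) ∧
      ∀ x, pairEnergy Ψ J x < e → ∀ j ∈ J, gap j x < ρ := by
  obtain ⟨C, hC, hCΦ⟩ := hΦ.exists_lower_bound
  -- With this threshold, a pair beyond `ρ` would by itself force the energy to be at least `e`, for
  -- `Φ` and for `Ψ` alike.
  obtain ⟨ρ, Ψ, h⟩ := hΦ.exists_isCutoff hσ (e + J.card * C)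
  have hcore : ∀ q, q < -σ → -C ≤ Φ q := fun q hq =>
    hCΦ q (by rw [abs_of_neg (by linarith)]; linarith)
  refine ⟨_, ρ, Ψ, h, fun x hx hxe j hj => ?_, fun x hxe j hj => ?_⟩
  · by_contra hcon
    exact (lt_of_pairEnergy_lt (fun k hk => hcore _ (hx k hk)) hC hxe hj).not_gt
      (h.high_core _ (not_lt.1 hcon) (hx j hj))
  · by_contra hcon
    refine (lt_of_pairEnergy_lt (fun k _ => ?_) hC hxe hj).not_gt (h.high _ (not_lt.1 hcon))
    rcases lt_or_ge (gap k x) ρ with hk | hk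
    · rw [h.eq _ hk]; exact hcore _ (hk.trans h.lt)
    · have h1 := h.high _ hk
      have : 0 ≤ J.card * C := by positivity
      linarith

/-- Trajectories of the particles in which only the pairs in `J` interact. -/
def IsPairTrajectory (Φ : ℝ → ℝ) (σ : ℝ) (J : Finset (Fin (n - 1))) (γ : ℝ → Phase n) : Prop :=
  ∀ t, γ t ∈ pairAllowed σ J ∧ HasDerivAt γ (pairField (deriv Φ) J (γ t)) t

theorem IsCutoff.pairField_eq {Φ Ψ : ℝ → ℝ} {σ c ρ : ℝ} (h : IsCutoff Φ σ c ρ Ψ)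
    {J : Finset (Fin (n - 1))} {x : Phase n} (hx : ∀ j ∈ J, gap j x < ρ) :
    pairField (deriv Ψ) J x = pairField (deriv Φ) J x := by
  exact congrArg _ (Finset.sum_congr rfl fun j hj => by rw [h.deriv_eq (hx j hj)])

theorem IsCutoff.pairEnergy_eq {Φ Ψ : ℝ → ℝ} {σ c ρ : ℝ} (h : IsCutoff Φ σ c ρ Ψ)
    {J : Finset (Fin (n - 1))} {x : Phase n} (hx : ∀ j ∈ J, gap j x < ρ) :
    pairEnergy Ψ J x = pairEnergy Φ J x := by
  exact congrArg _ (Finset.sum_congr rfl fun j hj => by rw [h.eq _ (hx j hj)])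

theorem IsCorePotential.differentiableAt {Φ : ℝ → ℝ} {σ R : ℝ} (hΦ : IsCorePotential Φ σ R)
    (hσ : 0 < σ) {q : ℝ} (hq : q < -σ) : DifferentiableAt ℝ Φ q :=
  (hΦ.contDiffAt (by rw [abs_of_neg (by linarith)]; linarith)).differentiableAt two_ne_zero

/-- Below any energy the motion is the restriction of a smooth volume preserving global flow. -/
theorem IsCorePotential.exists_flow_below {Φ : ℝ → ℝ} {σ R : ℝ} (hΦ : IsCorePotential Φ σ R)
    (hσ : 0 < σ) (J : Finset (Fin (n - 1))) {e : ℝ} (he : 0 ≤ e) :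
    ∃ Y : ℝ → Phase n → Phase n, ContDiff ℝ 1 (fun z : ℝ × Phase n => Y z.1 z.2) ∧
      (∀ t x, (fderiv ℝ (Y t) x).det = 1) ∧
      ∀ x ∈ pairAllowed σ J, pairEnergy Φ J x < e →
        Y 0 x = x ∧ IsPairTrajectory Φ σ J (fun t => Y t x) ∧
        ∀ γ, IsPairTrajectory Φ σ J γ → γ 0 = x → ∀ t, γ t = Y t x := by
  obtain ⟨c, ρ, Ψ, h, hlow, hlow'⟩ := hΦ.exists_pair_cutoff hσ J he
  have hΨ : ContDiff ℝ 1 (deriv Ψ) := (contDiff_succ_iff_deriv.1 h.contDiff).2.2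
  obtain ⟨K, hK⟩ := exists_lipschitzWith_pairField hΨ h.hasCompactSupport J
  obtain ⟨Y, hY⟩ := exists_isLipschitzFlow hK
  have hd := (contDiff_pairField hΨ J).differentiable one_ne_zero
  have hu := uniformContinuous_fderiv_pairField hΨ h.hasCompactSupport J
  refine ⟨Y, hY.contDiff hd hu, fun t x => hY.det_fderiv_eq_one hd hu (fun x =>
    trace_fderiv_pairField J fun j _ => hΨ.differentiable one_ne_zero _) t x,
    fun x hx hxe => ⟨hY.zero x, fun t => ?_, fun γ hγ hγ0 t => ?_⟩⟩
  -- Conservation of the cutoff energy confines the orbit to the region where the cutoff and the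
  -- true potential agree.
  · have h1 : pairEnergy Ψ J (Y t x) = pairEnergy Ψ J (Y 0 x) :=
      pairEnergy_eq_of_hasDerivAt (γ := fun t => Y t x)
        (fun t j _ => h.contDiff.differentiable two_ne_zero _) (hY.deriv x) t
    rw [hY.zero, h.pairEnergy_eq (hlow x hx hxe)] at h1
    have h2 := hlow' (Y t x) (h1 ▸ hxe)
    exact ⟨fun j hj => (h2 j hj).trans h.lt, h.pairField_eq h2 ▸ hY.deriv x t⟩
  -- Conversely, conservation of the true energy makes every true trajectory solve the cutoff
  -- equation, whose solutions are unique.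
  · have h1 : ∀ t, HasDerivAt γ (pairField (deriv Ψ) J (γ t)) t := fun t => by
      have h2 := pairEnergy_eq_of_hasDerivAt
        (fun t j hj => hΦ.differentiableAt hσ ((hγ t).1 j hj)) (fun t => (hγ t).2) t
      rw [h.pairField_eq (hlow _ (hγ t).1 (by rw [h2, hγ0]; exact hxe))]
      exact (hγ t).2
    rw [hY.eq_of_hasDerivAt h1 t, hγ0]

/-- The flow of the particles in which only the pairs in `J` interact. -/
structure IsPairFlow (Φ : ℝ → ℝ) (σ : ℝ) (J : Finset (Fin (n - 1)))
    (Y : ℝ → Phase n → Phase n) : Prop where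
  zero : ∀ x ∈ pairAllowed σ J, Y 0 x = x
  trajectory : ∀ x ∈ pairAllowed σ J, IsPairTrajectory Φ σ J fun t => Y t x
  unique : ∀ γ, IsPairTrajectory Φ σ J γ → ∀ t, γ t = Y t (γ 0)
  contDiffOn : ContDiffOn ℝ 1 (fun z : ℝ × Phase n => Y z.1 z.2) (univ ×ˢ pairAllowed σ J)
  det : ∀ t, ∀ x ∈ pairAllowed σ J, (fderiv ℝ (Y t) x).det = 1

theorem IsCorePotential.continuousOn_pairEnergy {Φ : ℝ → ℝ} {σ R : ℝ} (hΦ : IsCorePotential Φ σ R)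
    (hσ : 0 < σ) (J : Finset (Fin (n - 1))) : ContinuousOn (pairEnergy Φ J) (pairAllowed σ J) := by
  unfold pairEnergy
  refine ContinuousOn.add (by fun_prop) (continuousOn_finsetSum _ fun j hj x hx => ?_)
  exact ((hΦ.differentiableAt hσ (hx j hj)).continuousAt.comp
    (gap j).continuous.continuousAt).continuousWithinAt

theorem IsCorePotential.exists_pairTrajectory {Φ : ℝ → ℝ} {σ R : ℝ} (hΦ : IsCorePotential Φ σ R)
    (hσ : 0 < σ) {J : Finset (Fin (n - 1))} {x : Phase n} (hx : x ∈ pairAllowed σ J) :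
    ∃ γ, IsPairTrajectory Φ σ J γ ∧ γ 0 = x := by
  obtain ⟨Y, -, -, hY⟩ := hΦ.exists_flow_below hσ J
    (show 0 ≤ |pairEnergy Φ J x| + 1 by positivity)
  obtain ⟨h0, h1, -⟩ := hY x hx (by linarith [le_abs_self (pairEnergy Φ J x)])
  exact ⟨_, h1, h0⟩

/-- The energy is continuous, so one cutoff serves a whole neighbourhood of a point, and there `Y`
coincides for all times with the cutoff flow. Uniqueness, smoothness and unit Jacobian are thus
inherited locally, whatever the choice of trajectories defining `Y`. -/
theorem IsCorePotential.isPairFlow {Φ : ℝ → ℝ} {σ R : ℝ} (hΦ : IsCorePotential Φ σ R)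
    (hσ : 0 < σ) {J : Finset (Fin (n - 1))} {Y : ℝ → Phase n → Phase n}
    (h0 : ∀ x ∈ pairAllowed σ J, Y 0 x = x)
    (hY : ∀ x ∈ pairAllowed σ J, IsPairTrajectory Φ σ J fun t => Y t x) :
    IsPairFlow Φ σ J Y := by
  have hloc : ∀ x ∈ pairAllowed σ J, ∃ Z : ℝ → Phase n → Phase n,
      ContDiff ℝ 1 (fun z : ℝ × Phase n => Z z.1 z.2) ∧ (∀ t x, (fderiv ℝ (Z t) x).det = 1) ∧
      (∀ γ, IsPairTrajectory Φ σ J γ → γ 0 = x → ∀ t, γ t = Z t x) ∧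
      ∀ᶠ y in 𝓝 x, ∀ t, Y t y = Z t y := fun x hx => by
    obtain ⟨Z, h1, h2, h3⟩ := hΦ.exists_flow_below hσ J
      (show 0 ≤ |pairEnergy Φ J x| + 1 by positivity)
    have hxe : pairEnergy Φ J x < |pairEnergy Φ J x| + 1 := by
      linarith [le_abs_self (pairEnergy Φ J x)]
    refine ⟨Z, h1, h2, (h3 x hx hxe).2.2, ?_⟩
    have h4 := (isOpen_pairAllowed σ J).mem_nhds hx
    filter_upwards [h4, ((hΦ.continuousOn_pairEnergy hσ J).continuousAt h4).eventually_lt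
      continuousAt_const hxe] with y hy hye t
    exact (h3 y hy hye).2.2 _ (hY y hy) (h0 y hy) t
  refine ⟨h0, hY, fun γ hγ t => ?_, fun ⟨t, x⟩ hz => ?_, fun t x hx => ?_⟩
  · obtain ⟨Z, -, -, h3, h4⟩ := hloc (γ 0) (hγ 0).1
    rw [h3 γ hγ rfl t, h4.self_of_nhds t]
  · obtain ⟨Z, h1, -, -, h4⟩ := hloc x hz.2
    have h5 : (fun z : ℝ × Phase n => Y z.1 z.2) =ᶠ[𝓝 (t, x)] fun z => Z z.1 z.2 :=
      (continuous_snd.tendsto (t, x)).eventually h4 |>.mono fun z hz => hz z.1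
    exact (h1.contDiffAt.congr_of_eventuallyEq h5).contDiffWithinAt
  · obtain ⟨Z, -, h2, -, h4⟩ := hloc x hx
    rw [EventuallyEq.fderiv_eq (h4.mono fun y hy => hy t), h2]

namespace IsPairFlow

variable {Φ : ℝ → ℝ} {σ : ℝ} {J : Finset (Fin (n - 1))} {Y : ℝ → Phase n → Phase n}

theorem mem (h : IsPairFlow Φ σ J Y) (t : ℝ) {x : Phase n} (hx : x ∈ pairAllowed σ J) :
    Y t x ∈ pairAllowed σ J := (h.trajectory x hx t).1

theorem add (h : IsPairFlow Φ σ J Y) (s t : ℝ) {x : Phase n} (hx : x ∈ pairAllowed σ J) :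
    Y (s + t) x = Y s (Y t x) := by
  have := h.unique (fun s => Y (s + t) x) (fun s => ⟨h.mem _ hx,
    ((h.trajectory x hx) (s + t)).2.comp_add_const s t⟩) s
  simpa using this

theorem neg_apply (h : IsPairFlow Φ σ J Y) (t : ℝ) {x : Phase n} (hx : x ∈ pairAllowed σ J) :
    Y (-t) (Y t x) = x := by
  rw [← h.add _ _ hx, neg_add_cancel, h.zero x hx]

theorem apply_neg (h : IsPairFlow Φ σ J Y) (t : ℝ) {x : Phase n} (hx : x ∈ pairAllowed σ J) :
    Y t (Y (-t) x) = x := by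
  simpa using h.neg_apply (-t) hx

theorem contDiffAt (h : IsPairFlow Φ σ J Y) (t : ℝ) {x : Phase n} (hx : x ∈ pairAllowed σ J) :
    ContDiffAt ℝ 1 (fun z : ℝ × Phase n => Y z.1 z.2) (t, x) :=
  h.contDiffOn.contDiffAt ((isOpen_univ.prod (isOpen_pairAllowed σ J)).mem_nhds ⟨trivial, hx⟩)

theorem differentiableAt (h : IsPairFlow Φ σ J Y) (t : ℝ) {x : Phase n}
    (hx : x ∈ pairAllowed σ J) : DifferentiableAt ℝ (Y t) x := by
  have h1 := (h.contDiffAt t hx).differentiableAt one_ne_zero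
  have h2 : DifferentiableAt ℝ (fun y : Phase n => (t, y)) x := by fun_prop
  exact DifferentiableAt.comp (f := fun y : Phase n => (t, y)) x h1 h2

theorem continuousOn (h : IsPairFlow Φ σ J Y) (t : ℝ) : ContinuousOn (Y t) (pairAllowed σ J) :=
  fun _ hx => (h.differentiableAt t hx).continuousAt.continuousWithinAt

theorem injOn (h : IsPairFlow Φ σ J Y) (t : ℝ) : InjOn (Y t) (pairAllowed σ J) :=
  fun x hx y hy hxy => by rw [← h.neg_apply t hx, hxy, h.neg_apply t hy]

theorem image_eq (h : IsPairFlow Φ σ J Y) (t : ℝ) :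
    Y t '' pairAllowed σ J = pairAllowed σ J :=
  Subset.antisymm (image_subset_iff.2 fun _ hx => h.mem t hx)
    fun x hx => ⟨Y (-t) x, h.mem _ hx, h.apply_neg t hx⟩

/-- The flow preserves the volume. -/
theorem setIntegral_comp (h : IsPairFlow Φ σ J Y) (t : ℝ) (f : Phase n → ℝ) :
    ∫ x in pairAllowed σ J, f (Y t x) = ∫ x in pairAllowed σ J, f x := by
  have hA := (isOpen_pairAllowed σ J).measurableSet
  have h1 := integral_image_eq_integral_abs_det_fderiv_smul volume hA
    (fun x hx => (h.differentiableAt t hx).hasFDerivAt.hasFDerivWithinAt) (h.injOn t) f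
  rw [h.image_eq] at h1
  rw [h1]
  exact setIntegral_congr_fun hA fun x hx => by simp [h.det t x hx]

theorem integrableOn_comp_iff (h : IsPairFlow Φ σ J Y) (t : ℝ) (f : Phase n → ℝ) :
    IntegrableOn (fun x => f (Y t x)) (pairAllowed σ J) ↔ IntegrableOn f (pairAllowed σ J) := by
  have hA := (isOpen_pairAllowed σ J).measurableSet
  have h1 := integrableOn_image_iff_integrableOn_abs_det_fderiv_smul volume hA
    (fun x hx => (h.differentiableAt t hx).hasFDerivAt.hasFDerivWithinAt) (h.injOn t) f
  rw [h.image_eq] at h1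
  rw [h1]
  exact integrableOn_congr_fun (fun x hx => by simp [h.det t x hx]) hA

end IsPairFlow

end Mechanics

/-! ### The Hamiltonian flow as the flow in which all pairs interact. -/

section Trajectories

variable {n : ℕ} {Φ : ℝ → ℝ} {σ R : ℝ}

theorem IsCorePotential.hamField_eq (hΦ : IsCorePotential Φ σ R) (hσ : 0 < σ) {x : Phase n}
    (hx : x ∈ allowed σ n) : hamField Φ x = pairField (deriv Φ) Finset.univ x := by
  rw [← pairAllowed_univ] at hx
  have h1 : HasFDerivAt (hamiltonian Φ) (∑ i : Fin n, (momentum i x) • momentum i +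
      ∑ j : Fin (n - 1), deriv Φ (gap j x) • gap j) x := by
    refine HasFDerivAt.add (HasFDerivAt.fun_sum fun i _ => ?_) (HasFDerivAt.fun_sum fun j hj => ?_)
    · have h2 : HasDerivAt (fun p : ℝ => p ^ 2 / 2) (momentum i x) (momentum i x) := by
        refine ((hasDerivAt_pow 2 (momentum i x)).div_const 2).congr_deriv ?_
        norm_num
      exact h2.comp_hasFDerivAt x (momentum i).hasFDerivAt
    · exact (hΦ.differentiableAt hσ (hx j hj)).hasDerivAt.comp_hasFDerivAt x (gap j).hasFDerivAt
  have hP : ∀ k l : Fin n, (dirP k : Phase n) l = (0, if l = k then 1 else 0) := fun k l => by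
    rw [dirP, Pi.single_apply]; split_ifs <;> rfl
  have hQ : ∀ k l : Fin n, (dirQ k : Phase n) l = (if l = k then 1 else 0, 0) := fun k l => by
    rw [dirQ, Pi.single_apply]; split_ifs <;> rfl
  funext i
  rw [pairField_apply, hamField, h1.fderiv]
  ext
  · simp [hP]
  · simp only [add_apply, sum_apply, smul_apply, momentum_apply, gap_apply, hQ, smul_eq_mul,
      mul_zero, Finset.sum_const_zero, zero_add]
    rw [← Finset.sum_neg_distrib]
    refine Finset.sum_congr rfl fun j _ => ?_
    simp only [eq_comm (a := i)]
    ring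

theorem IsCorePotential.isTrajectory_iff (hΦ : IsCorePotential Φ σ R) (hσ : 0 < σ)
    {γ : ℝ → Phase n} : IsTrajectory Φ σ γ ↔ IsPairTrajectory Φ σ Finset.univ γ := by
  refine forall_congr' fun t => ?_
  rw [pairAllowed_univ]
  exact and_congr_right fun h => by rw [hΦ.hamField_eq hσ h]

theorem IsCorePotential.flow_spec (hΦ : IsCorePotential Φ σ R) (hσ : 0 < σ) {x : Phase n}
    (hx : x ∈ allowed σ n) : IsTrajectory Φ σ (fun t => flow Φ σ t x) ∧ flow Φ σ 0 x = x := by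
  have h : ∃ γ : ℝ → Phase n, IsTrajectory Φ σ γ ∧ γ 0 = x := by
    simp only [hΦ.isTrajectory_iff hσ]
    exact hΦ.exists_pairTrajectory hσ (pairAllowed_univ (n := n) σ ▸ hx)
  simp only [flow, dif_pos h]
  exact h.choose_spec

end Trajectories

/-! ### Independent motion of the blocks of a partition. -/

section Blocks

variable {n : ℕ} (c : Composition n)

/-- The pairs of nearest neighbours which belong to the same block. -/
def innerPairs : Finset (Fin (n - 1)) :=
  Finset.univ.filter fun j => c.index (leftOf j) = c.index (rightOf j)

/-- A pair of nearest neighbours of a block as a pair of nearest neighbours among all particles. -/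
def blockPair (k : Fin c.length) (j : Fin (c.blocksFun k - 1)) : Fin (n - 1) :=
  ⟨c.sizeUpTo k + j, by
    have h1 := (c.embedding k (rightOf j)).2
    rw [c.coe_embedding] at h1
    have h2 : ((rightOf j : Fin (c.blocksFun k)) : ℕ) = j + 1 := rfl
    omega⟩

theorem leftOf_blockPair (k : Fin c.length) (j : Fin (c.blocksFun k - 1)) :
    leftOf (blockPair c k j) = c.embedding k (leftOf j) := by
  ext; rw [c.coe_embedding]; rfl

theorem rightOf_blockPair (k : Fin c.length) (j : Fin (c.blocksFun k - 1)) :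
    rightOf (blockPair c k j) = c.embedding k (rightOf j) := by
  ext; rw [c.coe_embedding]; rfl

theorem blockPair_mem (k : Fin c.length) (j : Fin (c.blocksFun k - 1)) :
    blockPair c k j ∈ innerPairs c := by
  simp [innerPairs, leftOf_blockPair, rightOf_blockPair, c.index_embedding]

theorem blockPair_injective (k : Fin c.length) : Function.Injective (blockPair c k) :=
  fun i j h => by
    have : c.sizeUpTo k + (i : ℕ) = c.sizeUpTo k + j := congrArg Fin.val h
    exact Fin.ext (by omega)

theorem exists_blockPair {j : Fin (n - 1)} {k : Fin c.length} (h1 : c.index (leftOf j) = k)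
    (h2 : c.index (rightOf j) = k) : ∃ i, blockPair c k i = j := by
  obtain ⟨l, hl⟩ : leftOf j ∈ range (c.embedding k) := h1 ▸ c.mem_range_embedding _
  obtain ⟨r, hr⟩ : rightOf j ∈ range (c.embedding k) := h2 ▸ c.mem_range_embedding _
  have hl' := congrArg Fin.val hl
  have hr' := congrArg Fin.val hr
  rw [c.coe_embedding] at hl' hr'
  have e1 : ((leftOf j : Fin n) : ℕ) = j := rfl
  have e2 : ((rightOf j : Fin n) : ℕ) = j + 1 := rfl
  exact ⟨⟨l, by have := r.2; omega⟩, Fin.ext (by change c.sizeUpTo k + (l : ℕ) = j; omega)⟩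

theorem gap_blockConf (k : Fin c.length) (j : Fin (c.blocksFun k - 1)) (x : Phase n) :
    gap j (blockConf c k x) = gap (blockPair c k j) x := by
  simp only [gap_apply, leftOf_blockPair, rightOf_blockPair]; rfl

theorem forall_blockConf_mem_iff {σ : ℝ} {x : Phase n} :
    (∀ k, blockConf c k x ∈ allowed σ (c.blocksFun k)) ↔ x ∈ pairAllowed σ (innerPairs c) := by
  simp only [← pairAllowed_univ]
  constructor
  · intro h j hj
    obtain ⟨i, hi⟩ := exists_blockPair c (k := c.index (leftOf j)) rfl
      (by simpa [eq_comm, innerPairs] using hj)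
    rw [← hi, ← gap_blockConf]
    exact h _ i (Finset.mem_univ i)
  · intro h k i _
    rw [gap_blockConf]
    exact h _ (blockPair_mem c k i)

/-- The blocks decouple: an inner pair that contains a particle of block `k` lies entirely in that
block, so all other inner pairs exert no force on it. -/
theorem pairField_innerPairs_embedding (ψ : ℝ → ℝ) (x : Phase n) (k : Fin c.length)
    (l : Fin (c.blocksFun k)) : pairField ψ (innerPairs c) x (c.embedding k l) =
      pairField ψ Finset.univ (blockConf c k x) l := by
  rw [pairField_apply, pairField_apply]
  refine Prod.ext rfl (Eq.symm ?_)
  dsimp only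
  refine Finset.sum_of_injOn (M := ℝ) (blockPair c k) (blockPair_injective c k).injOn
    (fun j _ => blockPair_mem c k j) (fun j hj hj' => ?_) fun j _ => ?_
  · have hinner : c.index (leftOf j) = c.index (rightOf j) := by simpa [innerPairs] using hj
    have h1 : c.embedding k l ≠ rightOf j := fun h => hj' (by
      have h2 : c.index (rightOf j) = k := by rw [← h, c.index_embedding]
      obtain ⟨i, hi⟩ := exists_blockPair c (hinner.trans h2) h2
      exact ⟨i, by simp, hi⟩)
    have h2 : c.embedding k l ≠ leftOf j := fun h => hj' (by
      have h2 : c.index (leftOf j) = k := by rw [← h, c.index_embedding]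
      obtain ⟨i, hi⟩ := exists_blockPair c h2 (hinner.symm.trans h2)
      exact ⟨i, by simp, hi⟩)
    simp [h1, h2]
  · rw [gap_blockConf, leftOf_blockPair, rightOf_blockPair]
    simp only [(c.embedding k).injective.eq_iff]

/-- The particles of each block move along the Hamiltonian trajectories of this block alone. -/
noncomputable def blockFlow (Φ : ℝ → ℝ) (σ : ℝ) (t : ℝ) (x : Phase n) : Phase n :=
  fun i => flow Φ σ t (blockConf c (c.index i) x) (c.invEmbedding i)

theorem blockConf_blockFlow (Φ : ℝ → ℝ) (σ t : ℝ) (x : Phase n) (k : Fin c.length) :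
    blockConf c k (blockFlow c Φ σ t x) = flow Φ σ t (blockConf c k x) := by
  funext l
  -- The block and position recovered from `c.embedding k l` equal `k` and `l` only propositionally,
  -- and the position has a dependent type; equality in the sigma type transports both together.
  have h1 : ∀ p q : Σ k : Fin c.length, Fin (c.blocksFun k), p = q →
      flow Φ σ t (blockConf c p.1 x) p.2 = flow Φ σ t (blockConf c q.1 x) q.2 := by
    rintro p _ rfl; rfl
  exact h1 (c.blocksFinEquiv.symm (c.embedding k l)) ⟨k, l⟩
    (c.blocksFinEquiv.symm_apply_eq.2 rfl)

/-- A product of Liouville groups thus becomes composition with a single flow, to which the general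
facts on pair flows apply. -/
theorem IsCorePotential.isPairFlow_blockFlow {Φ : ℝ → ℝ} {σ R : ℝ} (hΦ : IsCorePotential Φ σ R)
    (hσ : 0 < σ) : IsPairFlow Φ σ (innerPairs c) (blockFlow c Φ σ) := by
  have hext : ∀ {x y : Phase n}, (∀ k l, x (c.embedding k l) = y (c.embedding k l)) → x = y :=
    fun {x y} h => funext fun i => by
      simpa [c.embedding_comp_inv] using h (c.index i) (c.invEmbedding i)
  refine hΦ.isPairFlow hσ (fun x hx => hext fun k l => ?_) fun x hx t => ⟨?_, ?_⟩
  · rw [← forall_blockConf_mem_iff] at hx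
    exact congrFun ((blockConf_blockFlow c Φ σ 0 x k).trans (hΦ.flow_spec hσ (hx k)).2) l
  · rw [← forall_blockConf_mem_iff] at hx ⊢
    intro k
    rw [blockConf_blockFlow]
    exact ((hΦ.flow_spec hσ (hx k)).1 t).1
  · rw [← forall_blockConf_mem_iff] at hx
    rw [hasDerivAt_pi]
    intro i
    obtain ⟨k, l, rfl⟩ : ∃ k l, c.embedding k l = i := ⟨_, _, c.embedding_comp_inv i⟩
    have h1 := (hΦ.flow_spec hσ (hx k)).1 t
    have h2 := hasDerivAt_pi.1 h1.2 l
    rw [hΦ.hamField_eq hσ h1.1] at h2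
    simp only [← blockConf_blockFlow, ← pairField_innerPairs_embedding] at h2
    exact h2

theorem blockGroups_eq {Φ : ℝ → ℝ} {σ t : ℝ} {F : Phase n → ℝ} :
    blockGroups Φ σ t c F =
      (pairAllowed σ (innerPairs c)).indicator fun x => F (blockFlow c Φ σ (-t) x) := by
  classical
  funext x
  rw [blockGroups, indicator_apply]
  simp only [forall_blockConf_mem_iff]
  rfl

end Blocks

/-! ### Products along lists of consecutive interval lengths. -/

section ListProd

/-- The product of the weights `W a s` of the consecutive intervals `[a, a + s)` of lengths `s`
listed in `l`, the first of which starts at the given point. -/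
def intervalProd (W : ℕ → ℕ → ℝ) : ℕ → List ℕ → ℝ
  | _, [] => 1
  | a, s :: l => W a s * intervalProd W (a + s) l

theorem intervalProd_append (W : ℕ → ℕ → ℝ) (a : ℕ) (l₁ l₂ : List ℕ) :
    intervalProd W a (l₁ ++ l₂) = intervalProd W a l₁ * intervalProd W (a + l₁.sum) l₂ := by
  induction l₁ generalizing a with
  | nil => simp [intervalProd]
  | cons s l ih => simp [intervalProd, ih, mul_assoc, add_assoc]

theorem intervalProd_shift {W W' : ℕ → ℕ → ℝ} {A : ℕ} {l : List ℕ} {a : ℕ}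
    (h : ∀ b s, b + s ≤ a + l.sum → W' b s = W (A + b) s) :
    intervalProd W' a l = intervalProd W (A + a) l := by
  induction l generalizing a with
  | nil => rfl
  | cons s l ih =>
    rw [intervalProd, intervalProd, h a s (by simp), ih fun b r hb => h b r (by simp; omega),
      add_assoc]

theorem intervalProd_eq_prod (W : ℕ → ℕ → ℝ) (a : ℕ) (l : List ℕ) :
    intervalProd W a l = ∏ i : Fin l.length, W (a + (l.take i).sum) l[i] := by
  induction l generalizing a with
  | nil => simp [intervalProd]
  | cons s l ih => simp [intervalProd, ih, Fin.prod_univ_succ, add_assoc]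

theorem intervalProd_flatten (W : ℕ → ℕ → ℝ) (a : ℕ) (L : List (List ℕ)) :
    intervalProd W a L.flatten =
      ∏ i : Fin L.length, intervalProd W (a + ((L.map List.sum).take i).sum) L[i] := by
  induction L generalizing a with
  | nil => simp [intervalProd]
  | cons l L ih => simp [intervalProd_append, ih, Fin.prod_univ_succ, add_assoc]

/-- With positive entries, the partial sum determines the place of the cut. -/
theorem List.append_inj_of_sum_eq {l₁ l₂ r₁ r₂ : List ℕ} (hl : ∀ i ∈ l₁, 0 < i)
    (hr : ∀ i ∈ r₁, 0 < i) (hs : l₁.sum = r₁.sum) (h : l₁ ++ l₂ = r₁ ++ r₂) :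
    l₁ = r₁ ∧ l₂ = r₂ := by
  induction l₁ generalizing r₁ with
  | nil =>
    cases r₁ with
    | nil => exact ⟨rfl, h⟩
    | cons r r₁ =>
      have := hr r (by simp)
      simp at hs
      omega
  | cons s l ih =>
    cases r₁ with
    | nil =>
      have := hl s (by simp)
      simp at hs
      omega
    | cons r r₁ =>
      simp only [List.cons_append, List.cons.injEq] at h
      obtain ⟨rfl, h⟩ := h
      have := ih (fun i hi => hl i (by simp [hi])) (fun i hi => hr i (by simp [hi]))
        (by simpa using hs) h
      exact ⟨by rw [this.1], this.2⟩

end ListProd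

/-! ### Products over blocks and their regrouping. -/

section BlockProd

variable {n : ℕ}

theorem negCount_eq (c : Composition n) (k : Fin c.length) (m : ℕ) :
    negCount c k m = min (c.blocksFun k) (m - c.sizeUpTo k) := by
  have h1 : (Finset.univ.filter fun l : Fin (c.blocksFun k) => (c.embedding k l : ℕ) < m) =
      Finset.univ.filter fun l : Fin (c.blocksFun k) => (l : ℕ) < m - c.sizeUpTo k := by
    ext l
    rw [Finset.mem_filter, Finset.mem_filter, c.coe_embedding]
    simp only [Finset.mem_univ, true_and]
    exact Nat.lt_sub_iff_add_lt'.symm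
  rw [negCount, h1, Fin.card_filter_val_lt]

/-- The value of the member of a double sequence at the particles in `[a, a + s)`. -/
def intervalWeight (g : DoubleSeq) (m : ℕ) (x : Phase n) (a s : ℕ) : ℝ :=
  if h : a + s ≤ n then g s (min s (m - a)) (fun l => x ⟨a + l, by omega⟩) else 0

/-- Plain lists of lengths with a weight on all intervals replace the dependent block types, so that
partitions can be cut and joined without casts. -/
theorem blockProd_eq_intervalProd (g : DoubleSeq) (m : ℕ) (c : Composition n) (x : Phase n) :
    blockProd g m c x = intervalProd (intervalWeight g m x) 0 c.blocks := by
  rw [intervalProd_eq_prod, blockProd]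
  refine Finset.prod_congr rfl fun k _ => ?_
  have h1 : 0 + (c.blocks.take k).sum + c.blocks[k] ≤ n := by
    have h2 := c.sizeUpTo_le (k + 1)
    rw [c.sizeUpTo_succ'] at h2
    rwa [Nat.zero_add]
  rw [intervalWeight, dif_pos h1, negCount_eq]
  have h2 : ∀ (A B : ℕ) (hA : A + c.blocksFun k ≤ n) (hB : B + c.blocksFun k ≤ n), A = B →
      g (c.blocksFun k) (min (c.blocksFun k) (m - A)) (fun l => x ⟨A + l, by omega⟩) =
      g (c.blocksFun k) (min (c.blocksFun k) (m - B)) (fun l => x ⟨B + l, by omega⟩) := by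
    rintro A B _ _ rfl; rfl
  exact h2 (c.sizeUpTo k) _ (by rwa [Nat.zero_add] at h1) h1 (by simp [Composition.sizeUpTo])

/-- Only the number of negatively numbered particles inside the interval matters, so `m'` may be
truncated at `s` or not. -/
theorem blockProd_restrict (g : DoubleSeq) {m m' s A : ℕ} (hA : A + s ≤ n)
    (hm : min s m' = min s (m - A)) (x : Phase n) (c : Composition s) :
    blockProd g m' c (fun l => x ⟨A + l, by omega⟩) =
      intervalProd (intervalWeight g m x) A c.blocks := by
  rw [blockProd_eq_intervalProd]
  refine intervalProd_shift (A := A) (a := 0) fun b r hb => ?_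
  rw [zero_add, c.blocks_sum] at hb
  rw [intervalWeight, intervalWeight, dif_pos (by omega), dif_pos (by omega),
    show min r (m' - b) = min r (m - (A + b)) by omega]
  simp only [Nat.add_assoc]

/-- The blocks of `c`, cut into groups according to `b`, are the partitions induced on the blocks of
`c.gather b`; the product over all blocks factors accordingly. -/
theorem blockProd_gather (g : DoubleSeq) (m : ℕ) (c : Composition n) (b : Composition c.length)
    (x : Phase n) : blockProd g m c x = ∏ i : Fin (c.gather b).length,
      blockProd g (negCount (c.gather b) i m) (c.sigmaCompositionAux b i)
        (blockConf (c.gather b) i x) := by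
  have h1 : ∀ i : Fin (c.gather b).length,
      blockProd g (negCount (c.gather b) i m) (c.sigmaCompositionAux b i)
        (blockConf (c.gather b) i x) = intervalProd (intervalWeight g m x)
          ((c.gather b).sizeUpTo i) (c.sigmaCompositionAux b i).blocks := fun i => by
    refine blockProd_restrict g (m := m) (A := (c.gather b).sizeUpTo i) ?_ ?_ x _
    · have := (c.gather b).sizeUpTo_le (i + 1)
      rwa [(c.gather b).sizeUpTo_succ'] at this
    · rw [negCount_eq]; omega
  rw [blockProd_eq_intervalProd, ← c.blocks.flatten_splitWrtComposition b, intervalProd_flatten]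
  simp only [h1]
  refine Fintype.prod_equiv (finCongr (by simp [Composition.length, Composition.gather])) _ _
    fun i => ?_
  simp only [Composition.sizeUpTo, Composition.gather, Composition.sigmaCompositionAux, zero_add,
    Fin.getElem_fin]
  rfl

end BlockProd

/-! ### Cutting a partition at a pair, and alternating sums over partitions. -/

section Splitting

variable {n : ℕ}

/-- If the block of the right neighbour began earlier, it would also contain the left neighbour;
hence the right neighbour, in position `j + 1` counted from zero, begins its block. -/
theorem sizeUpTo_index_rightOf (d : Composition n) {j : Fin (n - 1)} (hj : j ∉ innerPairs d) :
    d.sizeUpTo (d.index (rightOf j)) = j + 1 := by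
  by_contra hne
  apply hj
  have e1 : ((leftOf j : Fin n) : ℕ) = j := rfl
  have e2 : ((rightOf j : Fin n) : ℕ) = j + 1 := rfl
  have h1 := d.sizeUpTo_index_le (rightOf j)
  have h2 := d.lt_sizeUpTo_index_succ (rightOf j)
  have h3 : leftOf j ∈ range (d.embedding (d.index (rightOf j))) :=
    d.mem_range_embedding_iff.2 ⟨by omega, by simp only [Nat.succ_eq_add_one, Fin.val_succ] at *; omega⟩
  simpa [innerPairs, eq_comm] using d.mem_range_embedding_iff'.1 h3

theorem notMem_innerPairs_of_sizeUpTo_eq (d : Composition n) {j : Fin (n - 1)} {k : ℕ}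
    (hk : d.sizeUpTo k = j + 1) : j ∉ innerPairs d := by
  intro hj
  have hj' : d.index (leftOf j) = d.index (rightOf j) := by simpa [innerPairs] using hj
  have e1 : ((leftOf j : Fin n) : ℕ) = j := rfl
  have e2 : ((rightOf j : Fin n) : ℕ) = j + 1 := rfl
  have h1 := d.sizeUpTo_index_le (leftOf j)
  have h2 := d.lt_sizeUpTo_index_succ (rightOf j)
  rw [hj'] at h1
  simp only [Fin.val_succ] at h2
  rcases Nat.lt_or_ge (d.index (rightOf j)) k with h | h
  · have := d.monotone_sizeUpTo (show (d.index (rightOf j) : ℕ) + 1 ≤ k from h)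
    omega
  · have := d.monotone_sizeUpTo h
    omega

/-- The partitions in which the particles of the `j`-th pair belong to different blocks are the
pairs of partitions of the particles on the left and on the right. -/
theorem sum_notMem_innerPairs (j : Fin (n - 1)) (f : List ℕ → ℝ) :
    ∑ d : Composition n with j ∉ innerPairs d, f d.blocks =
      ∑ d₁ : Composition (j + 1), ∑ d₂ : Composition (n - (j + 1)),
        f (d₁.blocks ++ d₂.blocks) := by
  rw [← Fintype.sum_prod_type']
  symm
  have hn : (j : ℕ) + 1 + (n - (j + 1)) = n := by omega
  refine Finset.sum_of_injOn
    (fun d : Composition (j + 1) × Composition (n - (j + 1)) => (d.1.append d.2).cast hn)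
    (fun d _ d' _ h => ?_) (fun d _ => ?_) (fun d hd hd' => ?_) fun d _ => rfl
  · have h1 : d.1.blocks ++ d.2.blocks = d'.1.blocks ++ d'.2.blocks := congrArg Composition.blocks h
    obtain ⟨h2, h3⟩ := List.append_inj_of_sum_eq (fun i => d.1.blocks_pos) (fun i => d'.1.blocks_pos)
      (d.1.blocks_sum.trans d'.1.blocks_sum.symm) h1
    exact Prod.ext (Composition.ext h2) (Composition.ext h3)
  · rw [Finset.mem_coe, Finset.mem_filter]
    refine ⟨Finset.mem_univ _, notMem_innerPairs_of_sizeUpTo_eq _ (k := d.1.length) ?_⟩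
    change ((d.1.blocks ++ d.2.blocks).take d.1.blocks.length).sum = _
    rw [List.take_left, d.1.blocks_sum]
  · exfalso
    apply hd'
    -- The preimage is obtained by cutting the list of blocks just before the block of the right
    -- neighbour.
    have hk := sizeUpTo_index_rightOf d (Finset.mem_filter.1 hd).2
    set k : ℕ := (d.index (rightOf j)).val
    have hk2 : (d.blocks.drop k).sum = n - (j + 1) := by
      have h1 := List.sum_take_add_sum_drop d.blocks k
      rw [d.blocks_sum] at h1
      change (d.blocks.take k).sum = j + 1 at hk
      omega
    exact ⟨(⟨d.blocks.take k, fun h => d.blocks_pos (List.mem_of_mem_take h), hk⟩,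
      ⟨d.blocks.drop k, fun h => d.blocks_pos (List.mem_of_mem_drop h), hk2⟩), by simp,
      Composition.ext (List.take_append_drop k d.blocks)⟩

/-- Splits a unit off the first block, or joins the first block to the second one if it is of
length one. -/
def toggleHead : List ℕ → List ℕ
  | 1 :: u :: l => (u + 1) :: l
  | (s + 2) :: l => 1 :: (s + 1) :: l
  | l => l

/-- `toggleHead` is an involution without fixed points that changes the number of blocks by one, so
the terms cancel in pairs. -/
theorem sum_neg_one_pow_length (hn : 2 ≤ n) :
    ∑ b : Composition n, (-1 : ℝ) ^ (b.length - 1) = 0 := by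
  have key : ∀ b : Composition n, (∃ u l, 0 < u ∧ b.blocks = 1 :: u :: l) ∨
      ∃ s l, b.blocks = (s + 2) :: l := fun b => by
    have hp : ∀ i ∈ b.blocks, 0 < i := fun i => b.blocks_pos
    have hs := b.blocks_sum
    rcases h : b.blocks with _ | ⟨_ | _ | s, l⟩ <;> rw [h] at hp hs
    · simp at hs; omega
    · exact absurd (hp 0 (by simp)) (lt_irrefl 0)
    · rcases l with _ | ⟨u, l⟩
      · simp at hs; omega
      · exact Or.inl ⟨u, l, hp u (by simp), rfl⟩
    · exact Or.inr ⟨s, l, rfl⟩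
  let g : Composition n → Composition n := fun b => ⟨toggleHead b.blocks, fun {i} hi => by
      rcases key b with ⟨u, l, hu, h⟩ | ⟨s, l, h⟩ <;> rw [h] at hi <;>
        simp only [toggleHead, List.mem_cons] at hi
      · rcases hi with rfl | hi
        · omega
        · exact b.blocks_pos (by rw [h]; simp [hi])
      · rcases hi with rfl | rfl | hi
        · omega
        · omega
        · exact b.blocks_pos (by rw [h]; simp [hi]), by
      have h0 := b.blocks_sum
      rcases key b with ⟨u, l, hu, h⟩ | ⟨s, l, h⟩ <;> rw [h] at h0 ⊢ <;>
        simp only [toggleHead, List.sum_cons] at h0 ⊢ <;> omega⟩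
  have hg : ∀ b, (g b).blocks = toggleHead b.blocks := fun _ => rfl
  refine Finset.sum_involution (fun b _ => g b) (fun b _ => ?_) (fun b _ _ h => ?_)
    (fun _ _ => Finset.mem_univ _) fun b _ => Composition.ext ?_
  · simp only [Composition.length, hg]
    rcases key b with ⟨u, l, hu, h⟩ | ⟨s, l, h⟩ <;> rw [h] <;> simp [toggleHead, pow_succ]
  · have h1 := congrArg Composition.blocks h
    rw [hg] at h1
    rcases key b with ⟨u, l, hu, h⟩ | ⟨s, l, h⟩ <;> rw [h] at h1 <;>
      simp [toggleHead] at h1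
  · rw [hg, hg]
    rcases key b with ⟨u, l, hu, h⟩ | ⟨s, l, h⟩ <;> rw [h]
    · obtain ⟨u, rfl⟩ := Nat.exists_eq_succ_of_ne_zero hu.ne'
      rfl
    · rfl

end Splitting

/-! ### Cluster expansion, the product identity, and the initial condition. -/

section Cumulants

variable {Φ : ℝ → ℝ} {σ R : ℝ} {n : ℕ}

open Classical in
/-- The evolution by the Liouville groups of the sums of the products over all partitions. -/
noncomputable def evolvedSum (Φ : ℝ → ℝ) (σ : ℝ) (g0 : DoubleSeq) (t : ℝ) : DoubleSeq :=
  fun n m x => if x ∈ allowed σ n then ∑ c : Composition n, blockProd g0 m c (flow Φ σ (-t) x)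
    else 0

/-- A pair `(c, b)` amounts to the partition `d = c.gather b` together with a partition of each
block of `d`. The weight and the evolution depend on `d` alone and the evolution acts blockwise, so
for fixed `d` the sum of products is a product of sums, one `evolvedSum` per block. The weight is
kept general so that it can also select the `d` that cut a given pair. -/
theorem sum_blockGroups_gather (g0 : DoubleSeq) (t : ℝ) (m : ℕ) (w : Composition n → ℝ)
    {x : Phase n} (hx : x ∈ allowed σ n) :
    ∑ c : Composition n, ∑ b : Composition c.length,
        w (c.gather b) * blockGroups Φ σ t (c.gather b) (blockProd g0 m c) x =
      ∑ d : Composition n, w d * blockProd (evolvedSum Φ σ g0 t) m d x := by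
  have hblock : ∀ (d : Composition n) k, blockConf d k x ∈ allowed σ (d.blocksFun k) := fun d =>
    (forall_blockConf_mem_iff d).2 (allowed_subset_pairAllowed σ _ hx)
  have h1 : ∀ (c : Composition n) (b : Composition c.length),
      w (c.gather b) * blockGroups Φ σ t (c.gather b) (blockProd g0 m c) x =
      w (c.gather b) * ∏ i : Fin (c.gather b).length,
        blockProd g0 (negCount (c.gather b) i m) (c.sigmaCompositionAux b i)
          (flow Φ σ (-t) (blockConf (c.gather b) i x)) := fun c b => by
    rw [blockGroups_eq, indicator_of_mem (allowed_subset_pairAllowed σ _ hx),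
      blockProd_gather g0 m c b]
    simp only [blockConf_blockFlow]
  simp only [h1]
  rw [← Fintype.sum_sigma']
  refine ((Composition.sigmaEquivSigmaPi n).sum_comp fun p => w p.1 * ∏ i : Fin p.1.length,
    blockProd g0 (negCount p.1 i m) (p.2 i) (flow Φ σ (-t) (blockConf p.1 i x))).trans ?_
  rw [Fintype.sum_sigma]
  refine Finset.sum_congr rfl fun d _ => ?_
  dsimp only
  rw [← Finset.mul_sum, blockProd]
  simp only [evolvedSum, if_pos (hblock d _)]
  rw [Finset.prod_univ_sum, Fintype.piFinset_univ]

theorem correlation_eq (g0 : DoubleSeq) (t : ℝ) (m : ℕ) {x : Phase n} (hx : x ∈ allowed σ n) :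
    correlation Φ σ g0 t n m x =
      ∑ d : Composition n, (-1) ^ (d.length - 1) * blockProd (evolvedSum Φ σ g0 t) m d x := by
  rw [← sum_blockGroups_gather g0 t m _ hx, correlation, if_pos hx]
  simp only [cumulant, Composition.length_gather]

theorem restrict_mem_allowed {x : Phase n} (hx : x ∈ allowed σ n) {s A : ℕ} (hA : A + s ≤ n) :
    (fun l : Fin s => x ⟨A + l, by omega⟩) ∈ allowed σ s := by
  intro i
  exact hx ⟨A + i, by omega⟩

/-- The interaction term of the hierarchy collects the partitions with the members of the `j`-th
pair in different blocks. -/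
theorem sum_cumulant_notMem_innerPairs (g0 : DoubleSeq) (t : ℝ) {m : ℕ} (hm : m ≤ n)
    (j : Fin (n - 1)) {x : Phase n} (hx : x ∈ allowed σ n) :
    ∑ c : Composition n, ∑ b : Composition c.length, (if j ∈ innerPairs (c.gather b) then 0 else
        (-1) ^ (b.length - 1) * blockGroups Φ σ t (c.gather b) (blockProd g0 m c) x) =
      -splitProd (correlation Φ σ g0 t) m j x := by
  have h0 := sum_blockGroups_gather (Φ := Φ) g0 t m
    (fun d => if j ∈ innerPairs d then 0 else (-1) ^ (d.length - 1)) hx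
  simp only [ite_mul, zero_mul, Composition.length_gather] at h0
  rw [h0]
  set D := evolvedSum Φ σ g0 t
  set W := intervalWeight D m x
  have h1 : (∑ d : Composition n, if j ∈ innerPairs d then 0 else
      (-1 : ℝ) ^ (d.length - 1) * blockProd D m d x) =
      ∑ d : Composition n with j ∉ innerPairs d,
        (-1 : ℝ) ^ (d.blocks.length - 1) * intervalProd W 0 d.blocks := by
    rw [Finset.sum_filter]
    refine Finset.sum_congr rfl fun d _ => ?_
    rw [blockProd_eq_intervalProd, ite_not]
  have hl : correlation Φ σ g0 t (j + 1) (min m (j + 1)) (fun l => x ⟨l, by omega⟩) =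
      ∑ d : Composition (j + 1), (-1) ^ (d.length - 1) * intervalProd W 0 d.blocks := by
    have h2 := restrict_mem_allowed hx (s := j + 1) (A := 0) (by omega)
    simp only [zero_add] at h2
    rw [correlation_eq g0 t _ h2]
    refine Finset.sum_congr rfl fun d _ => ?_
    have h3 := blockProd_restrict D (n := n) (m := m) (m' := min m (j + 1)) (s := j + 1) (A := 0)
      (by omega) (by omega) x d
    simp only [zero_add] at h3
    rw [h3]
  have hr : correlation Φ σ g0 t (n - (j + 1)) (m - (j + 1))
      (fun l => x ⟨j + 1 + l, by omega⟩) = ∑ d : Composition (n - (j + 1)),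
        (-1) ^ (d.length - 1) * intervalProd W (j + 1) d.blocks := by
    rw [correlation_eq g0 t _ (restrict_mem_allowed hx (s := n - (j + 1)) (A := j + 1) (by omega))]
    refine Finset.sum_congr rfl fun d _ => ?_
    rw [blockProd_restrict D (n := n) (m := m) (m' := m - (j + 1)) (s := n - (j + 1)) (A := j + 1)
      (by omega) rfl x d]
  rw [h1, sum_notMem_innerPairs j fun l => (-1 : ℝ) ^ (l.length - 1) * intervalProd W 0 l,
    splitProd, hl, hr, Finset.sum_mul_sum, ← Finset.sum_neg_distrib]
  refine Finset.sum_congr rfl fun d₁ _ => ?_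
  rw [← Finset.sum_neg_distrib]
  refine Finset.sum_congr rfl fun d₂ _ => ?_
  -- Both halves are nonempty, so the truncated exponents satisfy `|d₁| + |d₂| - 1 = (|d₁| - 1) +
  -- (|d₂| - 1) + 1`; the extra one is the minus sign of the identity.
  rw [intervalProd_append, d₁.blocks_sum, List.length_append, zero_add]
  obtain ⟨a, ha⟩ := Nat.exists_eq_succ_of_ne_zero (d₁.length_pos_iff.2 (by omega)).ne'
  obtain ⟨b, hb⟩ := Nat.exists_eq_succ_of_ne_zero (d₂.length_pos_iff.2 (by omega)).ne'
  rw [d₁.blocks_length, d₂.blocks_length, ha, hb]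
  rw [show a.succ + b.succ - 1 = a + b + 1 by omega]
  simp only [Nat.succ_sub_one, pow_succ, pow_add]
  ring

/-- At time zero every flow is the identity, so a cumulant is multiplication by an alternating sum
over the partitions of the set of blocks; this is zero unless there is just one block. -/
theorem correlation_zero (hΦ : IsCorePotential Φ σ R) (hσ : 0 < σ) {g0 : DoubleSeq}
    (hg0 : IsL1Seq σ g0) {m : ℕ} (hn : 1 ≤ n) (hm : m ≤ n) (x : Phase n) :
    correlation Φ σ g0 0 n m x = g0 n m x := by
  by_cases hx : x ∈ allowed σ n
  swap
  · rw [correlation, if_neg hx, (hg0 n m hn hm).2 x hx]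
  have h1 : ∀ c : Composition n, cumulant Φ σ 0 c (blockProd g0 m c) x =
      blockProd g0 m c x * ∑ b : Composition c.length, (-1) ^ (b.length - 1) := fun c => by
    rw [cumulant, Finset.mul_sum]
    refine Finset.sum_congr rfl fun b _ => ?_
    have h2 := allowed_subset_pairAllowed σ (innerPairs (c.gather b)) hx
    rw [blockGroups_eq, indicator_of_mem h2, neg_zero,
      (hΦ.isPairFlow_blockFlow (c.gather b) hσ).zero x h2, mul_comm]
  rw [correlation, if_pos hx, Finset.sum_congr rfl fun c _ => h1 c,
    Finset.sum_eq_single (Composition.single n hn)]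
  · have h2 : blockProd g0 m (Composition.single n hn) x = g0 n m x := by
      rw [blockProd_eq_intervalProd, Composition.single_blocks, intervalProd, intervalProd,
        intervalWeight, dif_pos (by omega), mul_one]
      simp [hm]
    have h3 : ∀ k, k = 1 → ∑ b : Composition k, (-1 : ℝ) ^ (b.length - 1) = 1 := by
      rintro _ rfl
      have h4 : ∀ b : Composition 1, b.length - 1 = 0 := fun b => by
        have := b.length_le
        omega
      simp [h4, composition_card]
    rw [h2, h3 _ (Composition.single_length hn), mul_one]
  · intro c _ hc
    have h2 := c.length_pos_of_pos hn
    have h3 := (Composition.eq_single_iff_length hn).not.1 hc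
    rw [sum_neg_one_pow_length (by omega), mul_zero]
  · simp

end Cumulants

/-! ### Integrability and smoothness of products over blocks. -/

section BlockProdRegularity

variable {n : ℕ} (c : Composition n)

/-- The configurations of the particles as collections of configurations of the blocks. -/
def blockMeasurableEquiv : (∀ k : Fin c.length, Phase (c.blocksFun k)) ≃ᵐ Phase n where
  toFun z i := z (c.index i) (c.invEmbedding i)
  invFun x k := blockConf c k x
  left_inv z := by
    funext k l
    have h1 : ∀ p q : Σ k : Fin c.length, Fin (c.blocksFun k), p = q → z p.1 p.2 = z q.1 q.2 := by
      rintro p _ rfl; rfl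
    exact h1 (c.blocksFinEquiv.symm (c.embedding k l)) ⟨k, l⟩ (c.blocksFinEquiv.symm_apply_eq.2 rfl)
  right_inv x := by
    funext i
    exact congrArg x (c.embedding_comp_inv i)
  measurable_toFun := measurable_pi_lambda _ fun i =>
    (measurable_pi_apply (c.invEmbedding i)).comp (measurable_pi_apply (c.index i))
  measurable_invFun := measurable_pi_lambda _ fun k =>
    measurable_pi_lambda _ fun l => measurable_pi_apply _

theorem measurePreserving_blockMeasurableEquiv : MeasurePreserving (blockMeasurableEquiv c) := by
  refine ⟨(blockMeasurableEquiv c).measurable, Eq.symm (Measure.pi_eq fun s hs => ?_)⟩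
  rw [Measure.map_apply (blockMeasurableEquiv c).measurable (MeasurableSet.univ_pi hs)]
  have h1 : blockMeasurableEquiv c ⁻¹' univ.pi s =
      univ.pi fun k => univ.pi fun l => s (c.embedding k l) := by
    rw [← MeasurableEquiv.image_symm]
    ext z
    simp only [mem_image, Set.mem_pi, mem_univ, true_imp_iff]
    constructor
    · rintro ⟨x, hx, rfl⟩ k l
      exact hx _
    · intro hz
      refine ⟨blockMeasurableEquiv c z, fun i => ?_, (blockMeasurableEquiv c).symm_apply_apply z⟩
      have := hz (c.index i) (c.invEmbedding i)
      rwa [c.embedding_comp_inv] at this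
  rw [h1, volume_pi_pi]
  simp only [volume_pi_pi]
  exact c.prod_prod_apply_embedding fun i => volume (s i)

theorem negCount_le (k : Fin c.length) (m : ℕ) : negCount c k m ≤ c.blocksFun k :=
  (negCount_eq c k m).trans_le (min_le_left _ _)

/-- The factors depend on disjoint groups of variables, so in block coordinates this is a tensor
product of integrable functions. -/
theorem IsL1Seq.integrable_blockProd {σ : ℝ} {g : DoubleSeq} (hg : IsL1Seq σ g) (m : ℕ) :
    Integrable (blockProd g m c) := by
  rw [← (measurePreserving_blockMeasurableEquiv c).integrable_comp_emb
    (blockMeasurableEquiv c).measurableEmbedding]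
  have h1 : blockProd g m c ∘ blockMeasurableEquiv c =
      fun z => ∏ k, g (c.blocksFun k) (negCount c k m) (z k) := by
    funext z
    rw [Function.comp_apply, blockProd]
    exact Finset.prod_congr rfl fun k _ => congrArg (g _ _)
      (congrFun ((blockMeasurableEquiv c).symm_apply_apply z) k)
  rw [h1]
  exact Integrable.fintype_prod_dep fun k =>
    (hg _ _ (c.one_le_blocksFun k) (negCount_le c k m)).1

theorem IsSmoothSeq.contDiffOn_blockProd {σ : ℝ} {g : DoubleSeq} (hg : IsSmoothSeq σ g) (m : ℕ) :
    ContDiffOn ℝ 1 (blockProd g m c) (pairAllowed σ (innerPairs c)) := by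
  change ContDiffOn ℝ 1
    (fun x : Phase n => ∏ k, g (c.blocksFun k) (negCount c k m) (blockConf c k x)) _
  refine contDiffOn_prod fun k _ => ?_
  have h1 : ContDiff ℝ 1 (blockConf c k) := contDiff_pi.2 fun l => contDiff_apply _ _ _
  exact ((hg _ _ (c.one_le_blocksFun k) (negCount_le c k m)).1.of_le (by simp)).comp
    h1.contDiffOn fun x hx => (forall_blockConf_mem_iff c).2 hx k

/-- Gathering only removes boundaries between blocks. Hence configurations allowed for `c.gather b`
are allowed for `c`, where the initial product is smooth. -/
theorem innerPairs_subset_gather (b : Composition c.length) :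
    innerPairs c ⊆ innerPairs (c.gather b) := by
  intro j hj
  by_contra hcon
  have h1 := sizeUpTo_index_rightOf _ hcon
  have h2 : ((c.gather b).index (rightOf j) : ℕ) < b.length :=
    ((c.gather b).index (rightOf j)).2.trans_eq (c.length_gather b)
  have h3 := c.sizeUpTo_sizeUpTo_add b (j := 0) h2 (b.one_le_blocksFun _)
  rw [Composition.sizeUpTo_zero, add_zero, add_zero, h1] at h3
  exact notMem_innerPairs_of_sizeUpTo_eq c h3 hj

end BlockProdRegularity

/-! ### Liouville operators as derivatives along the fields. -/

section LiouvilleOperators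

variable {n : ℕ} {Φ : ℝ → ℝ} {σ R : ℝ}

theorem intL_eq (j : Fin (n - 1)) (f : Phase n → ℝ) (x : Phase n) :
    intL Φ j f x = -fderiv ℝ f x (deriv Φ (gap j x) • gapDir j) := by
  rw [intL, map_smul, gapDir, map_sub, gap_apply, smul_eq_mul]
  ring

/-- The interactions outside `J` are what the partial dynamics lacks of the full generator; summed
over the cluster terms they produce the nonlinear part of the hierarchy. -/
theorem liouvilleL_eq (J : Finset (Fin (n - 1))) (f : Phase n → ℝ) (x : Phase n) :
    liouvilleL Φ f x = -fderiv ℝ f x (pairField (deriv Φ) J x) +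
      ∑ j, if j ∈ J then 0 else intL Φ j f x := by
  have h1 : -fderiv ℝ f x (pairField (deriv Φ) J x) =
      ∑ i, freeL i f x + ∑ j ∈ J, intL Φ j f x := by
    simp only [intL_eq, pairField, map_add, map_sum, neg_add, Finset.sum_neg_distrib]
    congr 1
    rw [← Finset.sum_neg_distrib]
    refine Finset.sum_congr rfl fun i _ => ?_
    rw [freeL, map_smul, momentum_apply, smul_eq_mul, neg_mul]
  have h2 : ∑ j, intL Φ j f x = ∑ j ∈ J, intL Φ j f x + ∑ j, if j ∈ J then 0 else intL Φ j f x := by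
    rw [← Finset.sum_ite_mem_eq J, ← Finset.sum_add_distrib]
    refine Finset.sum_congr rfl fun j _ => ?_
    split_ifs <;> simp
  rw [h1, liouvilleL, h2, add_assoc]

theorem IsCorePotential.continuousAt_deriv (hΦ : IsCorePotential Φ σ R) (hσ : 0 < σ) {q : ℝ}
    (hq : q < -σ) : ContinuousAt (deriv Φ) q := by
  have h1 : q ∈ {q : ℝ | σ < |q|} := by
    change σ < |q|
    rw [abs_of_neg (by linarith)]
    linarith
  exact (hΦ.contDiffOn.continuousOn_deriv_of_isOpen (isOpen_outside_core σ) one_le_two).continuousAt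
    ((isOpen_outside_core σ).mem_nhds h1)

theorem isOpen_allowed (σ : ℝ) (n : ℕ) : IsOpen (allowed σ n) := by
  rw [← pairAllowed_univ]; exact isOpen_pairAllowed σ _

theorem IsCorePotential.continuousOn_pairField (hΦ : IsCorePotential Φ σ R) (hσ : 0 < σ)
    (J : Finset (Fin (n - 1))) : ContinuousOn (pairField (deriv Φ) J) (pairAllowed σ J) := by
  unfold pairField
  refine ContinuousOn.add (by fun_prop) (continuousOn_finsetSum _ fun j hj x hx => ?_)
  exact (((hΦ.continuousAt_deriv hσ (hx j hj)).comp
    (gap j).continuous.continuousAt).smul continuousAt_const).continuousWithinAt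

/-- The derivatives of a test function along a field which is continuous around its support. -/
theorem continuous_fderiv_apply {E : Type*} [NormedAddCommGroup E] [NormedSpace ℝ E] {φ : E → ℝ}
    {v : E → E} {U : Set E} (hU : IsOpen U) (hφ : ContDiff ℝ 1 φ) (hφU : tsupport φ ⊆ U)
    (hv : ContinuousOn v U) : Continuous fun x => fderiv ℝ φ x (v x) := by
  refine continuous_iff_continuousAt.2 fun x => ?_
  by_cases hx : x ∈ tsupport φ
  · exact (hφ.continuous_fderiv one_ne_zero).continuousAt.clm_apply
      (hv.continuousAt (hU.mem_nhds (hφU hx)))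
  · have h1 : (fun y => fderiv ℝ φ y (v y)) =ᶠ[𝓝 x] fun _ => 0 := by
      filter_upwards [(isClosed_tsupport φ).isOpen_compl.mem_nhds hx] with y hy
      rw [image_eq_zero_of_notMem_tsupport (f := fderiv ℝ φ)
        fun h => hy (tsupport_fderiv_subset ℝ h)]
      rfl
    exact continuousAt_const.congr h1.symm

theorem exists_bound_fderiv_apply {E : Type*} [NormedAddCommGroup E] [NormedSpace ℝ E] {φ : E → ℝ}
    {v : E → E} {U : Set E} (hU : IsOpen U) (hφ : ContDiff ℝ 1 φ) (hc : HasCompactSupport φ)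
    (hφU : tsupport φ ⊆ U) (hv : ContinuousOn v U) : ∃ C, ∀ x, ‖fderiv ℝ φ x (v x)‖ ≤ C := by
  refine HasCompactSupport.exists_bound_of_continuous ?_ (continuous_fderiv_apply hU hφ hφU hv)
  refine (hc.fderiv ℝ).mono fun x hx h => hx ?_
  simp only [h, zero_apply]

theorem fderiv_eq_zero_of_notMem {E : Type*} [NormedAddCommGroup E] [NormedSpace ℝ E] {φ : E → ℝ}
    {U : Set E} (hφU : tsupport φ ⊆ U) {x : E} (hx : x ∉ U) : fderiv ℝ φ x = 0 :=
  image_eq_zero_of_notMem_tsupport fun h => hx (hφU (tsupport_fderiv_subset ℝ h))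

end LiouvilleOperators

/-! ### Weak and classical Liouville equations for partial dynamics. -/

namespace IsPairFlow

variable {n : ℕ} {Φ : ℝ → ℝ} {σ R : ℝ} {J : Finset (Fin (n - 1))} {Y : ℝ → Phase n → Phase n}
  {F : Phase n → ℝ}

/-- The volume-preserving substitution `x ↦ Y t x` moves the evolution from `F` to the other factor.
-/
theorem integral_indicator_mul (h : IsPairFlow Φ σ J Y) (F u : Phase n → ℝ) (t : ℝ) :
    ∫ x, (pairAllowed σ J).indicator (fun x => F (Y (-t) x)) x * u x =
      ∫ x in pairAllowed σ J, F x * u (Y t x) := by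
  have hA := (isOpen_pairAllowed σ J).measurableSet
  simp only [← indicator_mul_left]
  rw [integral_indicator hA, ← h.setIntegral_comp t]
  exact setIntegral_congr_fun hA fun x hx => by simp only [h.neg_apply t hx]

theorem integrable_indicator (h : IsPairFlow Φ σ J Y) (hF : Integrable F) (t : ℝ) :
    Integrable ((pairAllowed σ J).indicator fun x => F (Y (-t) x)) :=
  ((h.integrableOn_comp_iff (-t) F).2 hF.integrableOn).integrable_indicator
    (isOpen_pairAllowed σ J).measurableSet

/-- The Liouville equation in the weak sense. -/
theorem hasDerivAt_integral (h : IsPairFlow Φ σ J Y) (hΦ : IsCorePotential Φ σ R) (hσ : 0 < σ)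
    (hF : Integrable F) {φ : Phase n → ℝ} (hφ : ContDiff ℝ 1 φ) (hc : HasCompactSupport φ)
    (hφA : tsupport φ ⊆ pairAllowed σ J) (t : ℝ) :
    HasDerivAt (fun s => ∫ x, (pairAllowed σ J).indicator (fun x => F (Y (-s) x)) x * φ x)
      (∫ x, (pairAllowed σ J).indicator (fun x => F (Y (-t) x)) x *
        fderiv ℝ φ x (pairField (deriv Φ) J x)) t := by
  have hA := isOpen_pairAllowed σ J
  -- Time now enters only through the test function, so integrability of `F` suffices and `‖F x‖ *
  -- C` dominates the derivative.
  simp only [h.integral_indicator_mul F]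
  have hv := hΦ.continuousOn_pairField hσ J
  have hu := continuous_fderiv_apply hA hφ hφA hv
  obtain ⟨C, hC⟩ := exists_bound_fderiv_apply hA hφ hc hφA hv
  obtain ⟨C', hC'⟩ := hc.exists_bound_of_continuous hφ.continuous
  have hmeas : ∀ {u : Phase n → ℝ}, Continuous u → ∀ s,
      AEStronglyMeasurable (fun x => u (Y s x)) (volume.restrict (pairAllowed σ J)) :=
    fun hu s => (hu.comp_continuousOn (h.continuousOn s)).aestronglyMeasurable hA.measurableSet
  refine (hasDerivAt_integral_of_dominated_loc_of_deriv_le (μ := volume.restrict (pairAllowed σ J))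
    (F := fun s x => F x * φ (Y s x))
    (F' := fun s x => F x * fderiv ℝ φ (Y s x) (pairField (deriv Φ) J (Y s x)))
    (bound := fun x => ‖F x‖ * C) (s := univ) univ_mem
    (Eventually.of_forall fun s => hF.1.restrict.mul (hmeas hφ.continuous s))
    (hF.restrict.mul_bdd (hmeas hφ.continuous t) (ae_of_all _ fun x => hC' _))
    (hF.1.restrict.mul (hmeas hu t)) (ae_of_all _ fun x s _ => ?_) (hF.restrict.norm.mul_const C)
    ((ae_restrict_iff' hA.measurableSet).2 (ae_of_all _ fun x hx s _ => ?_))).2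
  · rw [norm_mul]
    exact mul_le_mul_of_nonneg_left (hC _) (norm_nonneg _)
  · exact ((hφ.differentiable one_ne_zero _).hasFDerivAt.comp_hasDerivAt s
      (h.trajectory x hx s).2).const_mul (F x)

theorem contDiffAt_comp_neg (h : IsPairFlow Φ σ J Y) (hF : ContDiffOn ℝ 1 F (pairAllowed σ J))
    (t : ℝ) {x : Phase n} (hx : x ∈ pairAllowed σ J) :
    ContDiffAt ℝ 1 (fun z : ℝ × Phase n => F (Y (-z.1) z.2)) (t, x) := by
  have h1 : ContDiffAt ℝ 1 (fun z : ℝ × Phase n => Y (-z.1) z.2) (t, x) := by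
    have h2 : ContDiff ℝ 1 fun z : ℝ × Phase n => (-z.1, z.2) := by fun_prop
    exact ContDiffAt.comp (f := fun z : ℝ × Phase n => (-z.1, z.2)) (t, x)
      (h.contDiffAt (-t) hx) h2.contDiffAt
  exact ContDiffAt.comp (f := fun z : ℝ × Phase n => Y (-z.1) z.2) (t, x)
    (hF.contDiffAt ((isOpen_pairAllowed σ J).mem_nhds (h.mem (-t) hx))) h1

theorem differentiableAt_comp_neg (h : IsPairFlow Φ σ J Y)
    (hF : ContDiffOn ℝ 1 F (pairAllowed σ J)) (t : ℝ) {x : Phase n} (hx : x ∈ pairAllowed σ J) :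
    DifferentiableAt ℝ (fun y => F (Y (-t) y)) x := by
  have h2 : DifferentiableAt ℝ (fun y : Phase n => (t, y)) x := by fun_prop
  exact DifferentiableAt.comp (f := fun y : Phase n => (t, y)) x
    ((h.contDiffAt_comp_neg hF t hx).differentiableAt one_ne_zero) h2

/-- The Liouville equation in the classical sense. -/
theorem hasDerivAt_comp_neg (h : IsPairFlow Φ σ J Y) (hF : ContDiffOn ℝ 1 F (pairAllowed σ J))
    (t : ℝ) {x : Phase n} (hx : x ∈ pairAllowed σ J) :
    HasDerivAt (fun s => F (Y (-s) x))
      (-fderiv ℝ (fun y => F (Y (-t) y)) x (pairField (deriv Φ) J x)) t := by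
  have h0 := h.zero x hx
  -- Since `Y (-t) (Y (t - s) x) = Y (-s) x`, the time derivative at `t` is minus the derivative of
  -- the already evolved function along the field at `x`.
  have h1 : HasDerivAt (fun s => F (Y (-t) (Y s x)))
      (fderiv ℝ (fun y => F (Y (-t) y)) x (pairField (deriv Φ) J x)) 0 := by
    have h2 := (h.trajectory x hx 0).2
    have h3 := (h.differentiableAt_comp_neg hF t (h.mem 0 hx)).hasFDerivAt.comp_hasDerivAt 0 h2
    simp only [h0] at h3
    exact h3
  have h4 : HasDerivAt (fun s => F (Y (-t) (Y s x)))
      (fderiv ℝ (fun y => F (Y (-t) y)) x (pairField (deriv Φ) J x)) (t - t) := by rwa [sub_self]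
  have h5 := h4.comp_const_sub t t
  refine h5.congr_of_eventuallyEq (Eventually.of_forall fun s => ?_)
  simp only [← h.add _ _ hx]
  congr 2
  ring

end IsPairFlow

/-! ### Assembling the cluster terms into solutions of the hierarchy. -/

section Hierarchy

variable {Φ : ℝ → ℝ} {σ R : ℝ} {n : ℕ}

/-- The pairs of a partition and of a partition of the set of its blocks, which index the terms of
the correlation functions. -/
abbrev ClusterIndex (n : ℕ) : Type := Σ c : Composition n, Composition c.length

/-- The partition in which the parts of the partition of the set of blocks are declusterized. -/
def ClusterIndex.gather (p : ClusterIndex n) : Composition n := p.1.gather p.2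

/-- The sign of a term of the correlation functions. -/
def ClusterIndex.sign (p : ClusterIndex n) : ℝ := (-1) ^ (p.2.length - 1)

/-- A term of the correlation functions without its sign. -/
noncomputable def clusterTerm (Φ : ℝ → ℝ) (σ : ℝ) (g0 : DoubleSeq) (m : ℕ) (p : ClusterIndex n)
    (t : ℝ) : Phase n → ℝ := blockGroups Φ σ t p.gather (blockProd g0 m p.1)

theorem clusterTerm_eq (g0 : DoubleSeq) (m : ℕ) (p : ClusterIndex n) (t : ℝ) :
    clusterTerm Φ σ g0 m p t = (pairAllowed σ (innerPairs p.gather)).indicator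
      fun x => blockProd g0 m p.1 (blockFlow p.gather Φ σ (-t) x) := blockGroups_eq _

theorem clusterTerm_apply (g0 : DoubleSeq) (m : ℕ) (p : ClusterIndex n) (t : ℝ) {x : Phase n}
    (hx : x ∈ allowed σ n) :
    clusterTerm Φ σ g0 m p t x = blockProd g0 m p.1 (blockFlow p.gather Φ σ (-t) x) := by
  rw [clusterTerm_eq, indicator_of_mem (allowed_subset_pairAllowed σ _ hx)]

theorem correlation_eq_sum_clusterTerm (g0 : DoubleSeq) (t : ℝ) (m : ℕ) {x : Phase n}
    (hx : x ∈ allowed σ n) :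
    correlation Φ σ g0 t n m x = ∑ p : ClusterIndex n, p.sign * clusterTerm Φ σ g0 m p t x := by
  rw [correlation, if_pos hx, Fintype.sum_sigma]
  rfl

theorem splitProd_eq_sum_clusterTerm (g0 : DoubleSeq) (t : ℝ) {m : ℕ} (hm : m ≤ n)
    (j : Fin (n - 1)) {x : Phase n} (hx : x ∈ allowed σ n) :
    splitProd (correlation Φ σ g0 t) m j x =
      -∑ p : ClusterIndex n, if j ∈ innerPairs p.gather then 0
        else p.sign * clusterTerm Φ σ g0 m p t x := by
  rw [Fintype.sum_sigma, ← neg_eq_iff_eq_neg]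
  exact (sum_cumulant_notMem_innerPairs g0 t hm j hx).symm

theorem IsL1Seq.integrable_clusterTerm {g0 : DoubleSeq} (hg0 : IsL1Seq σ g0)
    (hΦ : IsCorePotential Φ σ R) (hσ : 0 < σ) (m : ℕ) (p : ClusterIndex n) (t : ℝ) :
    Integrable (clusterTerm Φ σ g0 m p t) := by
  rw [clusterTerm_eq]
  exact (hΦ.isPairFlow_blockFlow p.gather hσ).integrable_indicator
    (hg0.integrable_blockProd p.1 m) t

theorem IsL1Seq.isL1Seq_correlation {g0 : DoubleSeq} (hg0 : IsL1Seq σ g0) (hΦ : IsCorePotential Φ σ R)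
    (hσ : 0 < σ) (t : ℝ) : IsL1Seq σ (correlation Φ σ g0 t) := by
  intro n m _ _
  refine ⟨?_, fun x hx => if_neg hx⟩
  have h1 : correlation Φ σ g0 t n m = (allowed σ n).indicator fun x =>
      ∑ p : ClusterIndex n, p.sign * clusterTerm Φ σ g0 m p t x := by
    funext x
    by_cases hx : x ∈ allowed σ n
    · rw [indicator_of_mem hx, correlation_eq_sum_clusterTerm g0 t m hx]
    · rw [indicator_of_notMem hx]; exact if_neg hx
  rw [h1]
  exact (integrable_finsetSum _ fun p _ =>
    (hg0.integrable_clusterTerm hΦ hσ m p t).const_mul _).indicator (isOpen_allowed σ n).measurableSet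

/-- Outside the allowed configurations the cluster terms need not vanish although `correlation`
does; the expansion is legitimate under the integral because `u` vanishes there. -/
theorem integral_correlation_mul {g0 : DoubleSeq} (hg0 : IsL1Seq σ g0)
    (hΦ : IsCorePotential Φ σ R) (hσ : 0 < σ) (m : ℕ) (t : ℝ) {u : Phase n → ℝ} {C : ℝ}
    (hu : AEStronglyMeasurable u) (hC : ∀ x, ‖u x‖ ≤ C) (h0 : ∀ x ∉ allowed σ n, u x = 0) :
    ∫ x, correlation Φ σ g0 t n m x * u x =
      ∑ p : ClusterIndex n, p.sign * ∫ x, clusterTerm Φ σ g0 m p t x * u x := by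
  have h1 : (fun x => correlation Φ σ g0 t n m x * u x) = fun x =>
      ∑ p : ClusterIndex n, p.sign * (clusterTerm Φ σ g0 m p t x * u x) := by
    funext x
    by_cases hx : x ∈ allowed σ n
    · simp only [correlation_eq_sum_clusterTerm g0 t m hx, Finset.sum_mul, mul_assoc]
    · simp [h0 x hx]
  rw [h1, integral_finsetSum _ fun p _ => ((hg0.integrable_clusterTerm hΦ hσ m p t).mul_bdd hu
    (ae_of_all _ hC)).const_mul _]
  simp only [integral_const_mul]

theorem integral_splitProd_mul {g0 : DoubleSeq} (hg0 : IsL1Seq σ g0)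
    (hΦ : IsCorePotential Φ σ R) (hσ : 0 < σ) {m : ℕ} (hm : m ≤ n) (j : Fin (n - 1)) (t : ℝ)
    {u : Phase n → ℝ} {C : ℝ} (hu : AEStronglyMeasurable u) (hC : ∀ x, ‖u x‖ ≤ C)
    (h0 : ∀ x ∉ allowed σ n, u x = 0) :
    ∫ x, splitProd (correlation Φ σ g0 t) m j x * u x =
      -∑ p : ClusterIndex n, if j ∈ innerPairs p.gather then 0
        else p.sign * ∫ x, clusterTerm Φ σ g0 m p t x * u x := by
  have h1 : (fun x => splitProd (correlation Φ σ g0 t) m j x * u x) = fun x =>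
      -∑ p : ClusterIndex n, (if j ∈ innerPairs p.gather then 0 else p.sign) *
        (clusterTerm Φ σ g0 m p t x * u x) := by
    funext x
    by_cases hx : x ∈ allowed σ n
    · rw [splitProd_eq_sum_clusterTerm g0 t hm j hx, neg_mul, Finset.sum_mul]
      simp only [ite_mul, zero_mul, mul_assoc]
    · simp [h0 x hx]
  rw [h1, integral_neg, integral_finsetSum _ fun p _ =>
    ((hg0.integrable_clusterTerm hΦ hσ m p t).mul_bdd hu (ae_of_all _ hC)).const_mul _]
  simp only [integral_const_mul]
  simp only [ite_mul, zero_mul]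

theorem IsL1Seq.isWeakSolution {g0 : DoubleSeq} (hg0 : IsL1Seq σ g0) (hΦ : IsCorePotential Φ σ R)
    (hσ : 0 < σ) : IsWeakSolution Φ σ g0 (correlation Φ σ g0) := by
  refine ⟨hg0.isL1Seq_correlation hΦ hσ, fun n m hn hm =>
    ⟨ae_of_all _ (correlation_zero hΦ hσ hg0 hn hm), fun φ hφ hc hφA t => ?_⟩⟩
  have hA := isOpen_allowed σ n
  have hφ0 : ∀ x ∉ allowed σ n, φ x = 0 := fun x hx =>
    image_eq_zero_of_notMem_tsupport fun h => hx (hφA h)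
  obtain ⟨C, hC⟩ := hc.exists_bound_of_continuous hφ.continuous
  have hfield : ∀ J, ContinuousOn (pairField (n := n) (deriv Φ) J) (allowed σ n) := fun J =>
    (hΦ.continuousOn_pairField hσ J).mono (allowed_subset_pairAllowed σ J)
  have hforce : ∀ j : Fin (n - 1), ContinuousOn (fun x : Phase n => deriv Φ (gap j x) • gapDir j)
      (allowed σ n) := fun j x hx => by
    rw [← pairAllowed_univ] at hx
    exact (((hΦ.continuousAt_deriv hσ (hx j (Finset.mem_univ j))).comp
      (gap j).continuous.continuousAt).smul continuousAt_const).continuousWithinAt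
  have hint : ∀ j : Fin (n - 1), Continuous (intL Φ j φ) ∧ (∃ C, ∀ x, ‖intL Φ j φ x‖ ≤ C) ∧
      ∀ x ∉ allowed σ n, intL Φ j φ x = 0 := fun j => by
    have h1 : intL Φ j φ = fun x => -fderiv ℝ φ x (deriv Φ (gap j x) • gapDir j) :=
      funext fun x => intL_eq j φ x
    rw [h1]
    refine ⟨(continuous_fderiv_apply hA hφ hφA (hforce j)).neg, ?_, fun x hx => ?_⟩
    · simpa only [norm_neg] using exists_bound_fderiv_apply hA hφ hc hφA (hforce j)
    · simp only [fderiv_eq_zero_of_notMem hφA hx, zero_apply, neg_zero]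
  have hV : ∀ J, Continuous (fun x => fderiv ℝ φ x (pairField (deriv Φ) J x)) ∧
      (∃ C, ∀ x, ‖fderiv ℝ φ x (pairField (deriv Φ) J x)‖ ≤ C) ∧
      ∀ x ∉ allowed σ n, fderiv ℝ φ x (pairField (deriv Φ) J x) = 0 := fun J =>
    ⟨continuous_fderiv_apply hA hφ hφA (hfield J), exists_bound_fderiv_apply hA hφ hc hφA (hfield J),
      fun x hx => by rw [fderiv_eq_zero_of_notMem hφA hx]; simp⟩
  have hL : ∀ J, liouvilleL Φ φ = fun x => -fderiv ℝ φ x (pairField (deriv Φ) J x) +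
      ∑ j, if j ∈ J then 0 else intL Φ j φ x := fun J => funext fun x => liouvilleL_eq J φ x
  have hLuniv : liouvilleL Φ φ =
      fun x => -fderiv ℝ φ x (pairField (deriv Φ) Finset.univ x) := by
    rw [hL Finset.univ]; simp
  have hg := fun t => integral_correlation_mul hg0 hΦ hσ m t
    hφ.continuous.aestronglyMeasurable hC hφ0
  simp only [hg]
  have hterm : ∀ p : ClusterIndex n, HasDerivAt (fun s => ∫ x, clusterTerm Φ σ g0 m p s x * φ x)
      (∫ x, clusterTerm Φ σ g0 m p t x *
        fderiv ℝ φ x (pairField (deriv Φ) (innerPairs p.gather) x)) t := fun p => by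
    simp only [clusterTerm_eq]
    exact (hΦ.isPairFlow_blockFlow p.gather hσ).hasDerivAt_integral hΦ hσ
      (hg0.integrable_blockProd p.1 m) hφ hc (hφA.trans (allowed_subset_pairAllowed σ _)) t
  refine (HasDerivAt.fun_sum fun p _ => (hterm p).const_mul p.sign).congr_deriv ?_
  have hgL : ∫ x, correlation Φ σ g0 t n m x * liouvilleL Φ φ x =
      ∑ p : ClusterIndex n, p.sign * ∫ x, clusterTerm Φ σ g0 m p t x * liouvilleL Φ φ x := by
    rw [hLuniv]
    obtain ⟨C', hC'⟩ := (hV Finset.univ).2.1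
    exact integral_correlation_mul hg0 hΦ hσ m t (hV Finset.univ).1.neg.aestronglyMeasurable
      (fun x => (norm_neg _).trans_le (hC' x)) fun x hx => by rw [(hV Finset.univ).2.2 x hx, neg_zero]
  have hgI : ∀ j : Fin (n - 1), ∫ x, splitProd (correlation Φ σ g0 t) m j x * intL Φ j φ x =
      -∑ p : ClusterIndex n, if j ∈ innerPairs p.gather then 0
        else p.sign * ∫ x, clusterTerm Φ σ g0 m p t x * intL Φ j φ x := fun j => by
    obtain ⟨h1, ⟨C', hC'⟩, h2⟩ := hint j
    exact integral_splitProd_mul hg0 hΦ hσ hm j t h1.aestronglyMeasurable hC' h2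
  -- The splitting of the Liouville operator is adapted to each term: the pairs kept in the field
  -- are those inside the blocks along which this term evolves.
  have hpL : ∀ p : ClusterIndex n, ∫ x, clusterTerm Φ σ g0 m p t x * liouvilleL Φ φ x =
      -(∫ x, clusterTerm Φ σ g0 m p t x *
        fderiv ℝ φ x (pairField (deriv Φ) (innerPairs p.gather) x)) +
      ∑ j, if j ∈ innerPairs p.gather then 0
        else ∫ x, clusterTerm Φ σ g0 m p t x * intL Φ j φ x := fun p => by
    have hB := hg0.integrable_clusterTerm hΦ hσ m p t
    have hBI : ∀ j, Integrable fun x => (if j ∈ innerPairs p.gather then (0 : ℝ) else 1) *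
        (clusterTerm Φ σ g0 m p t x * intL Φ j φ x) := fun j => by
      obtain ⟨h1, ⟨C', hC'⟩, -⟩ := hint j
      exact (hB.mul_bdd h1.aestronglyMeasurable (ae_of_all _ hC')).const_mul _
    have hBV : Integrable fun x => -(clusterTerm Φ σ g0 m p t x *
        fderiv ℝ φ x (pairField (deriv Φ) (innerPairs p.gather) x)) := by
      obtain ⟨h1, ⟨C', hC'⟩, -⟩ := hV (innerPairs p.gather)
      exact (hB.mul_bdd h1.aestronglyMeasurable (ae_of_all _ hC')).neg
    have h1 : (fun x => clusterTerm Φ σ g0 m p t x * liouvilleL Φ φ x) = fun x =>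
        -(clusterTerm Φ σ g0 m p t x *
          fderiv ℝ φ x (pairField (deriv Φ) (innerPairs p.gather) x)) +
        ∑ j, (if j ∈ innerPairs p.gather then (0 : ℝ) else 1) *
          (clusterTerm Φ σ g0 m p t x * intL Φ j φ x) := by
      rw [hL (innerPairs p.gather)]
      funext x
      rw [mul_add, mul_neg, Finset.mul_sum]
      congr 1
      refine Finset.sum_congr rfl fun j _ => ?_
      split_ifs <;> simp
    rw [h1, integral_add hBV (integrable_finsetSum _ fun j _ => hBI j), integral_neg,
      integral_finsetSum _ fun j _ => hBI j]
    simp only [integral_const_mul]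
    simp only [ite_mul, zero_mul, one_mul]
  -- With the sum over pairs taken inside, the claim reduces to a single term: its cut interactions
  -- from the linear and the nonlinear part cancel, leaving its own transport equation.
  rw [hgL, Finset.sum_congr rfl fun j _ => hgI j, Finset.sum_neg_distrib, Finset.sum_comm, sub_neg_eq_add,
    ← Finset.sum_neg_distrib, ← Finset.sum_add_distrib]
  refine Finset.sum_congr rfl fun p _ => ?_
  rw [hpL p]
  have h2 : ∑ j, (if j ∈ innerPairs p.gather then 0
      else p.sign * ∫ x, clusterTerm Φ σ g0 m p t x * intL Φ j φ x) =
      p.sign * ∑ j, if j ∈ innerPairs p.gather then 0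
        else ∫ x, clusterTerm Φ σ g0 m p t x * intL Φ j φ x := by
    rw [Finset.mul_sum]
    simp only [mul_ite, mul_zero]
  rw [h2]
  ring

theorem IsSmoothSeq.isClassicalSolution {g0 : DoubleSeq} (hs : IsSmoothSeq σ g0)
    (hg0 : IsL1Seq σ g0) (hΦ : IsCorePotential Φ σ R) (hσ : 0 < σ) :
    IsClassicalSolution Φ σ g0 (correlation Φ σ g0) := by
  refine ⟨hg0.isL1Seq_correlation hΦ hσ, fun n m hn hm => ?_⟩
  have hA := isOpen_allowed σ n
  have hY := fun p : ClusterIndex n => hΦ.isPairFlow_blockFlow p.gather hσ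
  have hF : ∀ p : ClusterIndex n,
      ContDiffOn ℝ 1 (blockProd g0 m p.1) (pairAllowed σ (innerPairs p.gather)) := fun p =>
    -- The initial product is smooth where the blocks of `p.1` are allowed, while the flow lives
    -- where the larger gathered blocks are allowed.
    (hs.contDiffOn_blockProd p.1 m).mono (pairAllowed_anti (innerPairs_subset_gather p.1 p.2))
  have hsub : ∀ p : ClusterIndex n, allowed σ n ⊆ pairAllowed σ (innerPairs p.gather) := fun p =>
    allowed_subset_pairAllowed σ _
  refine ⟨?_, correlation_zero hΦ hσ hg0 hn hm, fun t x hx => ?_⟩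
  · have h1 : ContDiffOn ℝ 1 (fun z : ℝ × Phase n => ∑ p : ClusterIndex n,
        p.sign * blockProd g0 m p.1 (blockFlow p.gather Φ σ (-z.1) z.2)) (univ ×ˢ allowed σ n) :=
      ContDiffOn.sum fun p _ z hz => contDiffWithinAt_const.mul
        ((hY p).contDiffAt_comp_neg (hF p) z.1 (hsub p hz.2)).contDiffWithinAt
    refine h1.congr fun z hz => ?_
    rw [correlation_eq_sum_clusterTerm g0 z.1 m hz.2]
    simp only [clusterTerm_apply g0 m _ _ hz.2]
  · have hd : ∀ p : ClusterIndex n, HasFDerivAt (clusterTerm Φ σ g0 m p t)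
        (fderiv ℝ (clusterTerm Φ σ g0 m p t) x) x := fun p => by
      refine (((hY p).differentiableAt_comp_neg (hF p) t (hsub p hx)).congr_of_eventuallyEq
        ?_).hasFDerivAt
      filter_upwards [hA.mem_nhds hx] with y hy using clusterTerm_apply g0 m p t hy
    have hdt : ∀ p : ClusterIndex n, HasDerivAt (fun s => clusterTerm Φ σ g0 m p s x)
        (-fderiv ℝ (clusterTerm Φ σ g0 m p t) x
          (pairField (deriv Φ) (innerPairs p.gather) x)) t := fun p => by
      have h1 := (hY p).hasDerivAt_comp_neg (hF p) t (hsub p hx)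
      have h2 : clusterTerm Φ σ g0 m p t =ᶠ[𝓝 x]
          fun y => blockProd g0 m p.1 (blockFlow p.gather Φ σ (-t) y) := by
        filter_upwards [hA.mem_nhds hx] with y hy using clusterTerm_apply g0 m p t hy
      rw [h2.fderiv_eq]
      simpa only [clusterTerm_apply g0 m p _ hx] using h1
    have hg : fderiv ℝ (correlation Φ σ g0 t n m) x =
        ∑ p : ClusterIndex n, p.sign • fderiv ℝ (clusterTerm Φ σ g0 m p t) x := by
      have h1 : correlation Φ σ g0 t n m =ᶠ[𝓝 x]
          fun y => ∑ p : ClusterIndex n, p.sign * clusterTerm Φ σ g0 m p t y := by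
        filter_upwards [hA.mem_nhds hx] with y hy using correlation_eq_sum_clusterTerm g0 t m hy
      rw [h1.fderiv_eq]
      exact (HasFDerivAt.fun_sum fun p _ => (hd p).const_mul p.sign).fderiv
    -- The product identity holds on an open set, so it may be differentiated in `x`; the product of
    -- two correlation functions is differentiated through the cluster terms and not by the product
    -- rule.
    have hsp : ∀ j, fderiv ℝ (splitProd (correlation Φ σ g0 t) m j) x =
        -∑ p : ClusterIndex n, (if j ∈ innerPairs p.gather then 0 else p.sign) •
          fderiv ℝ (clusterTerm Φ σ g0 m p t) x := fun j => by
      have h1 : splitProd (correlation Φ σ g0 t) m j =ᶠ[𝓝 x] fun y => -∑ p : ClusterIndex n,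
          (if j ∈ innerPairs p.gather then 0 else p.sign) * clusterTerm Φ σ g0 m p t y := by
        filter_upwards [hA.mem_nhds hx] with y hy
        rw [splitProd_eq_sum_clusterTerm g0 t hm j hy]
        simp only [ite_mul, zero_mul]
      rw [h1.fderiv_eq]
      exact (HasFDerivAt.fun_sum fun p _ => (hd p).const_mul _).fun_neg.fderiv
    have h1 : (fun s => correlation Φ σ g0 s n m x) =
        fun s => ∑ p : ClusterIndex n, p.sign * clusterTerm Φ σ g0 m p s x :=
      funext fun s => correlation_eq_sum_clusterTerm g0 s m hx
    rw [h1]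
    refine (HasDerivAt.fun_sum fun p _ => (hdt p).const_mul p.sign).congr_deriv ?_
    have hgL : liouvilleL Φ (correlation Φ σ g0 t n m) x =
        ∑ p : ClusterIndex n, p.sign * liouvilleL Φ (clusterTerm Φ σ g0 m p t) x := by
      simp only [liouvilleL_eq Finset.univ, hg, Finset.mem_univ, if_true, Finset.sum_const_zero,
        add_zero, sum_apply, smul_apply, smul_eq_mul, mul_neg, Finset.sum_neg_distrib]
    have hgI : ∀ j, intL Φ j (splitProd (correlation Φ σ g0 t) m j) x =
        -∑ p : ClusterIndex n, p.sign *
          if j ∈ innerPairs p.gather then 0 else intL Φ j (clusterTerm Φ σ g0 m p t) x := fun j => by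
      simp only [intL_eq, hsp, neg_apply, sum_apply, smul_apply, smul_eq_mul, neg_neg,
        ite_mul, zero_mul, mul_ite, mul_zero, mul_neg]
      rw [← Finset.sum_neg_distrib]
      refine Finset.sum_congr rfl fun p _ => ?_
      split_ifs <;> simp
    rw [hgL, Finset.sum_congr rfl fun j _ => hgI j, Finset.sum_neg_distrib, Finset.sum_comm,
      ← sub_eq_add_neg, ← Finset.sum_sub_distrib]
    refine Finset.sum_congr rfl fun p _ => ?_
    rw [← Finset.mul_sum, liouvilleL_eq (innerPairs p.gather)]
    ring

end Hierarchy

theorem theorem1 (Φ : ℝ → ℝ) (σ R : ℝ) (hσ : 0 < σ) (hR : σ < R) (hΦ : IsCorePotential Φ σ R)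
    (g0 : DoubleSeq) (hg0 : IsL1Seq σ g0) :
    IsWeakSolution Φ σ g0 (correlation Φ σ g0) ∧
      (IsSmoothSeq σ g0 → IsClassicalSolution Φ σ g0 (correlation Φ σ g0)) :=
  ⟨hg0.isWeakSolution hΦ hσ, fun hs => hs.isClassicalSolution hg0 hΦ hσ⟩
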